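/- Let $(\Omega_1,\mu_1)$ and $(\Omega_2,\mu_2)$ be localizable measure spaces (semifinite, and every family of measurable sets has an essential supremum), let $1\le q\le p\le\infty$ with conjugate exponents $p',q'$, and let $\phi\in L^\infty(\Omega_1\times\Omega_2)$. All spaces are complex. Here $L^\infty(\Omega_1\times\Omega_2)$ is taken with respect to the complete locally determined product measure, that is, $\phi$ is measurable and uniformly essentially bounded on all rectangles $A\times B$ with $\mu_1(A),\mu_2(B)<\infty$; in the $\sigma$-finite case this is the usual $L^\infty$ space. Let $u_\phi:L^1(\Omega_1)\to L^\infty(\Omega_2)=L^1(\Omega_2)^*$ be the operator $u_\phi(f)=\int_{\Omega_1}\phi(s,\cdot)f(s)\,d\mu_1(s)$ (equality a.e. on every set of finite measure), and let $T_\phi:L^{p'}(\Omega_1)\otimes L^q(\Omega_2)\to\mathcal B(L^p(\Omega_1),L^q(\Omega_2))$ be the linear map with $[T_\phi(f\otimes g)](h)=\left(\int_{\Omega_1}\phi(s,\cdot)f(s)h(s)\,d\mu_1(s)\right)g$. The function $\phi$ is called a Schur multiplier on $\mathcal B(L^p(\Omega_1),L^q(\Omega_2))$ if there is a constant $C\ge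 0$ with $\|T_\phi(u)\|\le C\|u\|_\vee$ for all $u\in L^{p'}(\Omega_1)\otimes L^q(\Omega_2)$, where $\|\cdot\|_\vee$ is the injective tensor norm; $\|T_\phi\|$ is the infimum of such $C$. For Banach spaces $X,Y$ and $a,b\in[1,\infty]$ with $\frac1a+\frac1b\ge1$, put $\frac1r=\frac1a+\frac1b-1$ and, for $z\in X\otimes Y$, $$\alpha_{a,b}(z)=\inf\Big\{\|(\lambda_i)\|_{\ell_r}\,w_{b'}(x_i,X)\,w_{a'}(y_i,Y)\ :\ z=\sum_{i=1}^n\lambda_i\,x_i\otimes y_i\Big\},\qquad w_s(x_i,X)=\sup_{\|x^*\|\le1}\|(\langle x^*,x_i\rangle)_i\|_{\ell_s}.$$ The dual norm is $$\alpha_{a,b}'(z)=\inf_{M,N}\ \sup\{|\langle v,z\rangle| : v\in M^*\otimes N^*,\ \alpha_{a,b}(v)\le1\},$$ the infimum being over finite-dimensional subspaces $M\subset X$, $N\subset Y$ with $z\in M\otimes N$. A bounded operator $T:X\to Y^*$ is called $(a,b)$-factorable if there is $C\ge0$ with $|\langle T,\xi\rangle|\le C\,\alpha_{a,b}'(\xi)$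 for all $\xi\in X\otimes Y$, where $\langle T,\sum_i x_i\otimes y_i\rangle=\sum_i\langle T x_i,y_i\rangle$; $L_{a,b}(T)$ is the infimum of such $C$. Then $\phi$ is a Schur multiplier on $\mathcal B(L^p(\Omega_1),L^q(\Omega_2))$ if and only if $u_\phi$ is $(q,p')$-factorable. Moreover $\|T_\phi\|=L_{q,p'}(u_\phi)$. -/

import Mathlib

open MeasureTheory
open scoped ENNReal NNReal TensorProduct

namespace SchurLp

/-! ### Localizable measures and `L^∞` of a product -/

/-- A measure is localizable if it is semifinite and every family of measurable sets has an
essential supremum. -/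
class IsLocalizable {Ω : Type*} [MeasurableSpace Ω] (μ : Measure Ω) : Prop where
  semifinite : ∀ E, MeasurableSet E → μ E = ∞ →
    ∃ F, F ⊆ E ∧ MeasurableSet F ∧ 0 < μ F ∧ μ F < ∞
  exists_essSup : ∀ 𝓔 : Set (Set Ω), (∀ E ∈ 𝓔, MeasurableSet E) →
    ∃ H, MeasurableSet H ∧ (∀ E ∈ 𝓔, μ (E \ H) = 0) ∧
      ∀ G, MeasurableSet G → (∀ E ∈ 𝓔, μ (E \ G) = 0) → μ (H \ G) = 0

/-- `φ` represents an element of `L^∞(Ω₁ × Ω₂)`, where `Ω₁ × Ω₂` carries the complete locally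
determined product measure: a set is measurable (resp. null) for it if and only if its trace on
every rectangle `A × B` with sides of finite measure is measurable for the completion of the usual
(finite) product measure on `A × B` (resp. is null). When both measures are `σ`-finite this is the
usual `L^∞` of the product measure. -/
def MemLinftyProd {Ω₁ Ω₂ : Type*} [MeasurableSpace Ω₁] [MeasurableSpace Ω₂]
    (μ₁ : Measure Ω₁) (μ₂ : Measure Ω₂) (φ : Ω₁ × Ω₂ → ℂ) : Prop :=
  ∃ C : ℝ, ∀ A B, MeasurableSet A → MeasurableSet B → μ₁ A < ∞ → μ₂ B < ∞ →
    AEStronglyMeasurable φ ((μ₁.restrict A).prod (μ₂.restrict B)) ∧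
    ∀ᵐ x ∂(μ₁.restrict A).prod (μ₂.restrict B), ‖φ x‖ ≤ C

/-! ### The kernel operator `u_φ : L¹(Ω₁) → L^∞(Ω₂)` -/

section Kernel

variable {Ω : Type*} [MeasurableSpace Ω] {μ : Measure Ω}

/-- In a semifinite space a measurable, locally null set is null. -/
theorem measure_zero_of_local [IsLocalizable μ] {N : Set Ω} (hN : MeasurableSet N)
    (h : ∀ B, MeasurableSet B → μ B < ∞ → μ (N ∩ B) = 0) : μ N = 0 := by
  by_cases hfin : μ N = ∞
  · obtain ⟨F, hFN, hF, hpos, hlt⟩ := IsLocalizable.semifinite (μ := μ) N hN hfin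
    have := h F hF hlt
    rw [Set.inter_eq_right.2 hFN] at this
    exact absurd this hpos.ne'
  · simpa using h N hN (lt_top_iff_ne_top.2 hfin)

/-- Gluing of real functions that are measurable on all sets of finite measure. -/
theorem exists_glue_real [IsLocalizable μ] (F : Ω → ℝ)
    (hF : ∀ B, MeasurableSet B → μ B < ∞ → AEMeasurable F (μ.restrict B)) :
    ∃ g : Ω → ℝ, Measurable g ∧
      ∀ B, MeasurableSet B → μ B < ∞ → g =ᵐ[μ.restrict B] F := by
  have key : ∀ r : ℚ, ∃ H, MeasurableSet H ∧ ∀ B, MeasurableSet B → μ B < ∞ →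
      ∀ᵐ x ∂μ.restrict B, (x ∈ H ↔ (r : ℝ) < F x) := by
    intro r
    obtain ⟨H, hH, hup, hleast⟩ := IsLocalizable.exists_essSup (μ := μ)
      {E | MeasurableSet E ∧ μ E < ∞ ∧ ∀ᵐ x ∂μ.restrict E, (r : ℝ) < F x} (fun E hE => hE.1)
    refine ⟨H, hH, fun B hB hBf => ?_⟩
    obtain ⟨F', hF'm, hF'⟩ := hF B hB hBf
    have hF'B := (ae_restrict_iff' hB).1 hF'
    set P : Set Ω := {x | (r : ℝ) < F' x} with hP
    have hPm : MeasurableSet P := measurableSet_lt measurable_const hF'm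
    have h1 : μ ((B ∩ P) \ H) = 0 := by
      refine hup _ ⟨hB.inter hPm, (measure_mono Set.inter_subset_left).trans_lt hBf, ?_⟩
      rw [ae_restrict_iff' (hB.inter hPm)]
      filter_upwards [hF'B] with x hx hxm
      rw [hx hxm.1]
      exact hxm.2
    have h2 : μ (H \ (B \ P)ᶜ) = 0 := by
      refine hleast _ (hB.diff hPm).compl ?_
      rintro E ⟨hE, -, hEr⟩
      rw [ae_restrict_iff' hE] at hEr
      have : ∀ᵐ x ∂μ, x ∉ E \ (B \ P)ᶜ := by
        filter_upwards [hEr, hF'B] with x hx hx' hxm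
        simp only [Set.mem_sdiff, Set.mem_compl_iff, not_not] at hxm
        exact hxm.2.2 (show (r : ℝ) < F' x from hx' hxm.2.1 ▸ hx hxm.1)
      exact measure_eq_zero_iff_ae_notMem.2 this
    rw [ae_restrict_iff' hB]
    filter_upwards [hF'B, measure_eq_zero_iff_ae_notMem.1 h1,
      measure_eq_zero_iff_ae_notMem.1 h2] with x hx h1x h2x hxB
    rw [hx hxB]
    constructor
    · intro hxH
      by_contra hlt
      exact h2x ⟨hxH, fun hc => hc ⟨hxB, hlt⟩⟩
    · intro hlt
      by_contra hxH
      exact h1x ⟨⟨hxB, hlt⟩, hxH⟩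
  choose H hHm hH using key
  classical
  refine ⟨fun x => (⨆ r : ℚ, if x ∈ H r then ((r : ℝ) : EReal) else ⊥).toReal, ?_, ?_⟩
  · exact (Measurable.iSup fun r =>
      Measurable.ite (hHm r) measurable_const measurable_const).ereal_toReal
  · intro B hB hBf
    filter_upwards [ae_all_iff.2 fun r => hH r B hB hBf] with x hx
    have : (⨆ r : ℚ, if x ∈ H r then ((r : ℝ) : EReal) else ⊥) = (F x : EReal) := by
      apply le_antisymm
      · refine iSup_le fun r => ?_
        split_ifs with h
        · exact_mod_cast ((hx r).1 h).le
        · exact bot_le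
      · refine le_of_forall_lt fun c hc => ?_
        obtain ⟨r, hcr, hr⟩ := EReal.exists_rat_btwn_of_lt hc
        refine lt_of_lt_of_le hcr (le_iSup_of_le r ?_)
        rw [if_pos ((hx r).2 (by exact_mod_cast hr))]
    simp [this]

/-- Gluing of complex functions that are measurable and bounded on all sets of finite measure. -/
theorem exists_glue [IsLocalizable μ] (F : Ω → ℂ) (C : ℝ)
    (hF : ∀ B, MeasurableSet B → μ B < ∞ → AEStronglyMeasurable F (μ.restrict B) ∧
      ∀ᵐ x ∂μ.restrict B, ‖F x‖ ≤ C) :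
    ∃ g : Lp ℂ ∞ μ, (∀ᵐ x ∂μ, ‖g x‖ ≤ C) ∧
      ∀ B, MeasurableSet B → μ B < ∞ → g =ᵐ[μ.restrict B] F := by
  obtain ⟨a, ha, ha'⟩ := exists_glue_real (μ := μ) (fun x => (F x).re) fun B hB hBf =>
    Complex.measurable_re.comp_aemeasurable (hF B hB hBf).1.aemeasurable
  obtain ⟨b, hb, hb'⟩ := exists_glue_real (μ := μ) (fun x => (F x).im) fun B hB hBf =>
    Complex.measurable_im.comp_aemeasurable (hF B hB hBf).1.aemeasurable
  set g : Ω → ℂ := fun x => (a x : ℂ) + b x * Complex.I with hg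
  have hgm : Measurable g := by fun_prop
  have hgF : ∀ B, MeasurableSet B → μ B < ∞ → g =ᵐ[μ.restrict B] F := by
    intro B hB hBf
    filter_upwards [ha' B hB hBf, hb' B hB hBf] with x hx hx'
    simp [hg, hx, hx', Complex.re_add_im]
  have hbd : ∀ᵐ x ∂μ, ‖g x‖ ≤ C := by
    have hNm : MeasurableSet {x | C < ‖g x‖} := measurableSet_lt measurable_const hgm.norm
    have : μ {x | C < ‖g x‖} = 0 := by
      refine measure_zero_of_local hNm fun B hB hBf => ?_
      rw [measure_eq_zero_iff_ae_notMem]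
      have h1 := (ae_restrict_iff' hB).1 (hgF B hB hBf)
      have h2 := (ae_restrict_iff' hB).1 (hF B hB hBf).2
      filter_upwards [h1, h2] with x h1x h2x hx
      have h3 : C < ‖g x‖ := hx.1
      rw [h1x hx.2] at h3
      exact absurd (h2x hx.2) (not_le.2 h3)
    filter_upwards [measure_eq_zero_iff_ae_notMem.1 this] with x hx
    exact not_lt.1 hx
  have hmem : MemLp g ∞ μ := memLp_top_of_bound hgm.aestronglyMeasurable C hbd
  refine ⟨hmem.toLp g, ?_, fun B hB hBf => ?_⟩
  · filter_upwards [hmem.coeFn_toLp, hbd] with x hx hx'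
    rwa [hx]
  · filter_upwards [ae_restrict_of_ae hmem.coeFn_toLp, hgF B hB hBf] with x hx hx'
    rw [hx, hx']

/-- An element of `L^∞` is determined by its restrictions to the sets of finite measure. -/
theorem ext_of_local [IsLocalizable μ] {g h : Lp ℂ ∞ μ}
    (H : ∀ B, MeasurableSet B → μ B < ∞ → g =ᵐ[μ.restrict B] h) : g = h := by
  refine Lp.ext ?_
  have hNm : MeasurableSet {x | g x ≠ h x} :=
    (measurableSet_eq_fun (Lp.stronglyMeasurable g).measurable
      (Lp.stronglyMeasurable h).measurable).compl
  refine measure_zero_of_local hNm fun B hB hBf => ?_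
  rw [measure_eq_zero_iff_ae_notMem]
  filter_upwards [(ae_restrict_iff' hB).1 (H B hB hBf)] with x hx hxm
  exact hxm.1 (hx hxm.2)

variable {Ω₁ Ω₂ : Type*} [MeasurableSpace Ω₁] [MeasurableSpace Ω₂]
  {μ₁ : Measure Ω₁} {μ₂ : Measure Ω₂}

/-- Slices of `φ` against an integrable function. -/
theorem kernel_slices {φ : Ω₁ × Ω₂ → ℂ} {C : ℝ}
    (hφ : ∀ A B, MeasurableSet A → MeasurableSet B → μ₁ A < ∞ → μ₂ B < ∞ →
      AEStronglyMeasurable φ ((μ₁.restrict A).prod (μ₂.restrict B)) ∧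
      ∀ᵐ x ∂(μ₁.restrict A).prod (μ₂.restrict B), ‖φ x‖ ≤ C)
    (f : Lp ℂ 1 μ₁) {B : Set Ω₂} (hB : MeasurableSet B) (hBf : μ₂ B < ∞) :
    AEStronglyMeasurable (fun t => ∫ s, φ (s, t) * f s ∂μ₁) (μ₂.restrict B) ∧
    (∀ᵐ t ∂μ₂.restrict B, Integrable (fun s => φ (s, t) * f s) μ₁) ∧
    ∀ᵐ t ∂μ₂.restrict B, ‖∫ s, φ (s, t) * f s ∂μ₁‖ ≤ C * ‖f‖ := by
  obtain ⟨S, hS, hfS, hσ⟩ :=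
    (Lp.finStronglyMeasurable f one_ne_zero ENNReal.one_ne_top).exists_set_sigmaFinite
  have : IsFiniteMeasure (μ₂.restrict B) := ⟨by simpa using hBf⟩
  have hfi : Integrable f μ₁ := L1.integrable_coeFn f
  set D := spanningSets (μ₁.restrict S) with hD
  have hDm : ∀ n, MeasurableSet (D n) := measurableSet_spanningSets _
  have hU : (⋃ n, D n ×ˢ (Set.univ : Set Ω₂)) = Set.univ := by
    rw [← Set.iUnion_prod_const, iUnion_spanningSets, Set.univ_prod_univ]
  have hres : ∀ n, ((μ₁.restrict S).prod (μ₂.restrict B)).restrict (D n ×ˢ Set.univ)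
      = (μ₁.restrict (D n ∩ S)).prod (μ₂.restrict B) := by
    intro n
    rw [← Measure.prod_restrict, Measure.restrict_univ, Measure.restrict_restrict (hDm n)]
  have hfin : ∀ n, μ₁ (D n ∩ S) < ∞ := by
    intro n
    rw [← Measure.restrict_apply (hDm n)]
    exact measure_spanningSets_lt_top _ n
  have hm : AEStronglyMeasurable φ ((μ₁.restrict S).prod (μ₂.restrict B)) := by
    rw [← Measure.restrict_univ (μ := (μ₁.restrict S).prod (μ₂.restrict B)), ← hU,
      aestronglyMeasurable_iUnion_iff]
    intro n
    rw [hres]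
    exact (hφ _ _ ((hDm n).inter hS) hB (hfin n) hBf).1
  have hb : ∀ᵐ x ∂(μ₁.restrict S).prod (μ₂.restrict B), ‖φ x‖ ≤ C := by
    rw [← Measure.restrict_univ (μ := (μ₁.restrict S).prod (μ₂.restrict B)), ← hU,
      ae_restrict_iUnion_iff]
    intro n
    rw [hres]
    exact (hφ _ _ ((hDm n).inter hS) hB (hfin n) hBf).2
  have hm' : AEStronglyMeasurable (fun z : Ω₂ × Ω₁ => φ z.swap)
      ((μ₂.restrict B).prod (μ₁.restrict S)) := hm.prod_swap
  have hb' : ∀ᵐ z ∂(μ₂.restrict B).prod (μ₁.restrict S), ‖φ z.swap‖ ≤ C := by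
    rw [← Measure.prod_swap] at hb
    exact ae_of_ae_map measurable_swap.aemeasurable hb
  have hfS' : Function.support (f : Ω₁ → ℂ) ⊆ S := by
    intro s hs
    by_contra h
    exact hs (hfS s h)
  have hsupp : ∀ t, Function.support (fun s => φ (s, t) * f s) ⊆ S := fun t s hs =>
    hfS' (right_ne_zero_of_mul hs)
  have hint : ∀ t, ∫ s, φ (s, t) * f s ∂μ₁ = ∫ s in S, φ (s, t) * f s ∂μ₁ := fun t =>
    (setIntegral_eq_integral_of_forall_compl_eq_zero fun s hs => by simp [hfS s hs]).symm
  have hsl : ∀ᵐ t ∂μ₂.restrict B, AEStronglyMeasurable (fun s => φ (s, t)) (μ₁.restrict S) ∧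
      ∀ᵐ s ∂μ₁.restrict S, ‖φ (s, t)‖ ≤ C := by
    filter_upwards [hm'.prodMk_left, Measure.ae_ae_of_ae_prod hb'] with t h1 h2
    exact ⟨h1, h2⟩
  refine ⟨?_, ?_, ?_⟩
  · simp_rw [hint]
    have : AEStronglyMeasurable (fun z : Ω₂ × Ω₁ => φ z.swap * f z.2)
        ((μ₂.restrict B).prod (μ₁.restrict S)) :=
      hm'.mul ((Lp.stronglyMeasurable f).comp_measurable measurable_snd).aestronglyMeasurable
    exact this.integral_prod_right'
  · filter_upwards [hsl] with t ht
    rw [← integrableOn_iff_integrable_of_support_subset (hsupp t)]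
    exact hfi.integrableOn.bdd_mul ht.1 ht.2
  · filter_upwards [hsl] with t ht
    rw [hint, L1.norm_eq_integral_norm]
    calc ‖∫ s in S, φ (s, t) * f s ∂μ₁‖ ≤ ∫ s in S, C * ‖f s‖ ∂μ₁ := by
          refine norm_integral_le_of_norm_le (hfi.norm.integrableOn.const_mul C) ?_
          filter_upwards [ht.2] with s hs
          rw [norm_mul]
          exact mul_le_mul_of_nonneg_right hs (norm_nonneg _)
      _ = C * ∫ s, ‖f s‖ ∂μ₁ := by
          rw [integral_const_mul, setIntegral_eq_integral_of_forall_compl_eq_zero]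
          intro s hs
          simp [hfS s hs]

theorem exists_kernelOperator [IsLocalizable μ₂] {φ : Ω₁ × Ω₂ → ℂ}
    (hφ : MemLinftyProd μ₁ μ₂ φ) :
    ∃ u : Lp ℂ 1 μ₁ →L[ℂ] Lp ℂ ∞ μ₂, ∀ (f : Lp ℂ 1 μ₁) (B : Set Ω₂), MeasurableSet B →
      μ₂ B < ∞ → ∀ᵐ t ∂μ₂.restrict B, u f t = ∫ s, φ (s, t) * f s ∂μ₁ := by
  obtain ⟨C, hC⟩ := hφ
  choose g hgC hg using fun f : Lp ℂ 1 μ₁ => exists_glue (μ := μ₂)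
    (fun t => ∫ s, φ (s, t) * f s ∂μ₁) (C * ‖f‖) fun B hB hBf =>
      ⟨(kernel_slices hC f hB hBf).1, (kernel_slices hC f hB hBf).2.2⟩
  refine ⟨LinearMap.mkContinuous
    { toFun := g, map_add' := fun f₁ f₂ => ?_, map_smul' := fun c f => ?_ } |C| fun f => ?_,
    fun f B hB hBf => hg f B hB hBf⟩
  · refine ext_of_local fun B hB hBf => ?_
    filter_upwards [hg (f₁ + f₂) B hB hBf, hg f₁ B hB hBf, hg f₂ B hB hBf,
      ae_restrict_of_ae (Lp.coeFn_add (g f₁) (g f₂)), (kernel_slices hC f₁ hB hBf).2.1,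
      (kernel_slices hC f₂ hB hBf).2.1] with t h h1 h2 hadd hi1 hi2
    rw [h, hadd, Pi.add_apply, h1, h2, ← integral_add hi1 hi2]
    refine integral_congr_ae ?_
    filter_upwards [Lp.coeFn_add f₁ f₂] with s hs
    rw [hs, Pi.add_apply, mul_add]
  · refine ext_of_local fun B hB hBf => ?_
    filter_upwards [hg (c • f) B hB hBf, hg f B hB hBf,
      ae_restrict_of_ae (Lp.coeFn_smul c (g f))] with t h h1 hsm
    rw [h, RingHom.id_apply, hsm, Pi.smul_apply, h1, smul_eq_mul, ← integral_const_mul]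
    refine integral_congr_ae ?_
    filter_upwards [Lp.coeFn_smul c f] with s hs
    rw [hs, Pi.smul_apply, smul_eq_mul]
    ring
  · change ‖g f‖ ≤ |C| * ‖f‖
    rw [Lp.norm_def]
    refine ENNReal.toReal_le_of_le_ofReal (by positivity) ?_
    rw [eLpNorm_exponent_top]
    refine eLpNormEssSup_le_of_ae_bound ?_
    filter_upwards [hgC f] with t ht
    exact ht.trans (mul_le_mul_of_nonneg_right (le_abs_self C) (norm_nonneg f))

/-- The operator `u_φ : L¹(Ω₁) → L^∞(Ω₂)`, `u_φ f = ∫ φ(s, ·) f(s) dμ₁(s)`, the equality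
holding almost everywhere on every set of finite measure (which determines `u_φ f`). -/
noncomputable def kernelOperator [IsLocalizable μ₂] {φ : Ω₁ × Ω₂ → ℂ}
    (hφ : MemLinftyProd μ₁ μ₂ φ) : Lp ℂ 1 μ₁ →L[ℂ] Lp ℂ ∞ μ₂ :=
  (exists_kernelOperator hφ).choose

theorem kernelOperator_spec [IsLocalizable μ₂] {φ : Ω₁ × Ω₂ → ℂ}
    (hφ : MemLinftyProd μ₁ μ₂ φ) (f : Lp ℂ 1 μ₁) (B : Set Ω₂) (hB : MeasurableSet B)
    (hBf : μ₂ B < ∞) :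
    ∀ᵐ t ∂μ₂.restrict B, kernelOperator hφ f t = ∫ s, φ (s, t) * f s ∂μ₁ :=
  (exists_kernelOperator hφ).choose_spec f B hB hBf

/-- `u_φ` as an operator from `X = L¹(Ω₁)` to `Y^*` with `Y = L¹(Ω₂)`, where `L^∞(Ω₂) = L¹(Ω₂)^*`
through `⟨g, f⟩ = ∫ g f dμ₂`. -/
noncomputable def kernelOperatorDual [IsLocalizable μ₂] {φ : Ω₁ × Ω₂ → ℂ}
    (hφ : MemLinftyProd μ₁ μ₂ φ) : Lp ℂ 1 μ₁ →L[ℂ] StrongDual ℂ (Lp ℂ 1 μ₂) :=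
  ((ContinuousLinearMap.mul ℂ ℂ).lpPairing μ₂ ∞ 1) ∘L kernelOperator hφ

end Kernel

/-! ### Tensor norms -/

section TensorNorms

variable {X Y : Type*} [NormedAddCommGroup X] [NormedSpace ℂ X]
  [NormedAddCommGroup Y] [NormedSpace ℂ Y]

/-- The pairing `⟨v, u⟩ = ∑ ⟨x_j^*, x_i⟩ ⟨y_j^*, y_i⟩` of `X^* ⊗ Y^*` with `X ⊗ Y`. -/
noncomputable def tensorPairing (v : StrongDual ℂ X ⊗[ℂ] StrongDual ℂ Y) (u : X ⊗[ℂ] Y) : ℂ :=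
  TensorProduct.dualDistrib ℂ X Y
    (TensorProduct.map (ContinuousLinearMap.coeLM ℂ) (ContinuousLinearMap.coeLM ℂ) v) u

/-- The injective tensor norm `‖z‖_∨` on `X ⊗ Y`. -/
noncomputable def injNorm (z : X ⊗[ℂ] Y) : ℝ≥0∞ :=
  ⨆ (x' : StrongDual ℂ X) (_ : ‖x'‖ ≤ 1) (y' : StrongDual ℂ Y) (_ : ‖y'‖ ≤ 1),
    ‖tensorPairing (x' ⊗ₜ[ℂ] y') z‖ₑ

/-- The `ℓ_s^n`-norm of a finite family, `1 ≤ s ≤ ∞`. -/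
noncomputable def ellNorm {n : ℕ} (s : ℝ≥0∞) (a : Fin n → ℂ) : ℝ≥0∞ :=
  eLpNorm a s Measure.count

/-- The weak `ℓ_s`-norm `w_s(x_i, X)` of a finite family. -/
noncomputable def weakNorm {n : ℕ} (s : ℝ≥0∞) (x : Fin n → X) : ℝ≥0∞ :=
  ⨆ (x' : StrongDual ℂ X) (_ : ‖x'‖ ≤ 1), ellNorm s (fun i => x' (x i))

/-- The Lapresté norm `α_{p,q}` on `X ⊗ Y`, for `1 ≤ p, q ≤ ∞` and `1/p + 1/q ≥ 1`; here
`1/r = 1/p + 1/q - 1`. -/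
noncomputable def lapresteNorm (p q : ℝ≥0∞) (z : X ⊗[ℂ] Y) : ℝ≥0∞ :=
  ⨅ (n : ℕ) (c : Fin n → ℂ) (x : Fin n → X) (y : Fin n → Y)
    (_ : z = ∑ i, c i • (x i ⊗ₜ[ℂ] y i)),
    ellNorm (p⁻¹ + q⁻¹ - 1)⁻¹ c * weakNorm (ENNReal.conjExponent q) x *
      weakNorm (ENNReal.conjExponent p) y

/-- The dual norm `α_{p,q}'` on `M ⊗ N` for finite dimensional `M`, `N`. -/
noncomputable def lapresteDualNormFin (p q : ℝ≥0∞) (z : X ⊗[ℂ] Y) : ℝ≥0∞ :=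
  ⨆ (v : StrongDual ℂ X ⊗[ℂ] StrongDual ℂ Y) (_ : lapresteNorm p q v ≤ 1), ‖tensorPairing v z‖ₑ

/-- The dual norm `α_{p,q}'` on `X ⊗ Y`: the infimum of the norms in `M ⊗ N` over all finite
dimensional subspaces `M ⊆ X`, `N ⊆ Y` with `z ∈ M ⊗ N`. -/
noncomputable def lapresteDualNorm (p q : ℝ≥0∞) (z : X ⊗[ℂ] Y) : ℝ≥0∞ :=
  ⨅ (M : Submodule ℂ X) (N : Submodule ℂ Y) (_ : FiniteDimensional ℂ M)
    (_ : FiniteDimensional ℂ N) (w : M ⊗[ℂ] N) (_ : TensorProduct.mapIncl M N w = z),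
    lapresteDualNormFin p q w

/-- The pairing `⟨T, ξ⟩ = ∑ ⟨T x_i, y_i⟩` of `T : X → Y^*` with `ξ = ∑ x_i ⊗ y_i`. -/
noncomputable def opPairing (T : X →L[ℂ] StrongDual ℂ Y) (ξ : X ⊗[ℂ] Y) : ℂ :=
  TensorProduct.lift (ContinuousLinearMap.coeLM ℂ ∘ₗ (T : X →ₗ[ℂ] StrongDual ℂ Y)) ξ

/-- `C` is an admissible constant in the definition of `(p,q)`-factorability of `T`. -/
def FactorableBound (p q : ℝ≥0∞) (T : X →L[ℂ] StrongDual ℂ Y) (C : ℝ≥0) : Prop :=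
  ∀ ξ : X ⊗[ℂ] Y, ‖opPairing T ξ‖ₑ ≤ C * lapresteDualNorm p q ξ

/-- `T : X → Y^*` is `(p,q)`-factorable, i.e. `T ∈ 𝓛_{p,q}(X, Y^*)`. -/
def IsFactorable (p q : ℝ≥0∞) (T : X →L[ℂ] StrongDual ℂ Y) : Prop :=
  ∃ C : ℝ≥0, FactorableBound p q T C

/-- The norm `L_{p,q}(T)` (equal to `∞` if `T` is not `(p,q)`-factorable). -/
noncomputable def factorableNorm (p q : ℝ≥0∞) (T : X →L[ℂ] StrongDual ℂ Y) : ℝ≥0∞ :=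
  ⨅ (C : ℝ≥0) (_ : FactorableBound p q T C), (C : ℝ≥0∞)

end TensorNorms

/-! ### Schur multipliers -/

section Schur

variable {Ω₁ Ω₂ : Type*} [MeasurableSpace Ω₁] [MeasurableSpace Ω₂]
  {μ₁ : Measure Ω₁} {μ₂ : Measure Ω₂} [IsLocalizable μ₂]

/-- `T_φ : L^{p'}(Ω₁) ⊗ L^q(Ω₂) → 𝓑(L^p(Ω₁), L^q(Ω₂))`,
`[T_φ(f ⊗ g)](h) = (∫ φ(s, ·) f(s) h(s) dμ₁(s)) g`. -/
noncomputable def schurMap (p p' q : ℝ≥0∞) [ENNReal.HolderConjugate p p'] [Fact (1 ≤ p)]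
    [Fact (1 ≤ p')] [Fact (1 ≤ q)] {φ : Ω₁ × Ω₂ → ℂ} (hφ : MemLinftyProd μ₁ μ₂ φ) :
    Lp ℂ p' μ₁ ⊗[ℂ] Lp ℂ q μ₂ →ₗ[ℂ] (Lp ℂ p μ₁ →L[ℂ] Lp ℂ q μ₂) :=
  TensorProduct.lift <| LinearMap.mk₂ ℂ
    (fun f g => ((ContinuousLinearMap.mul ℂ ℂ).holderL μ₂ ∞ q q).flip g ∘L
      kernelOperator hφ ∘L (ContinuousLinearMap.mul ℂ ℂ).holderL μ₁ p' p 1 f)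
    (fun f₁ f₂ g => by ext1 h; simp only [map_add, ContinuousLinearMap.comp_apply,
      add_apply])
    (fun c f g => by ext1 h; simp only [map_smul, ContinuousLinearMap.comp_apply,
      smul_apply])
    (fun f g₁ g₂ => by ext1 h; simp only [map_add, ContinuousLinearMap.comp_apply,
      add_apply])
    (fun c f g => by ext1 h; simp only [map_smul, ContinuousLinearMap.comp_apply,
      smul_apply])

variable (p p' q : ℝ≥0∞) [ENNReal.HolderConjugate p p'] [Fact (1 ≤ p)]
  [Fact (1 ≤ p')] [Fact (1 ≤ q)] {φ : Ω₁ × Ω₂ → ℂ} (hφ : MemLinftyProd μ₁ μ₂ φ)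

/-- `T_φ` is bounded by `C` on `L^{p'}(Ω₁) ⊗ L^q(Ω₂)` with the injective tensor norm. -/
def SchurBound (C : ℝ≥0) : Prop :=
  ∀ u : Lp ℂ p' μ₁ ⊗[ℂ] Lp ℂ q μ₂, ‖schurMap p p' q hφ u‖ₑ ≤ C * injNorm u

/-- `φ` is a Schur multiplier on `𝓑(L^p(Ω₁), L^q(Ω₂))`. -/
def IsSchurMultiplier : Prop := ∃ C : ℝ≥0, SchurBound p p' q hφ C

/-- The norm `‖T_φ‖` (equal to `∞` if `φ` is not a Schur multiplier). -/
noncomputable def schurNorm : ℝ≥0∞ :=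
  ⨅ (C : ℝ≥0) (_ : SchurBound p p' q hφ C), (C : ℝ≥0∞)

end Schur

end SchurLp

namespace SchurLp

/-! ### The converse of Hölder's inequality -/

/-! The starting point is the identity `lpPairing_schurMap`: ⟨T_φ(u)h, k⟩ = ⟨u_φ, (M_h ⊗ M_k)u⟩ for
h ∈ L^p and k ∈ L^{q'}, where M_h and M_k multiply into L¹. By Hölder and its converse, T_φ is
bounded by C exactly when |⟨u_φ, (M_h ⊗ M_k)u⟩| ≤ C ‖u‖_∨ ‖h‖_p ‖k‖_{q'} for all u, h, k. What has
to be understood is therefore how the norm α'_{q,p'} on L¹ ⊗ L¹ relates to factorizations ξ = (M_h ⊗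
M_k)u weighted by ‖u‖_∨ ‖h‖_p ‖k‖_{q'}.

On step functions this is a question about matrices Z acting on ℓ_∞ × ℓ_∞. Put 1/ρ = 1/p + 1/q';
then ρ is conjugate to the exponent r of α_{q,p'}. If Z_{jk} = α_j β_k t_{jk} with α, β in the unit
balls of ℓ_p, ℓ_{q'} and t bounded by A on ℓ_p × ℓ_{q'}, Hölder bounds the pairing of Z with the
Lapresté norm by A (`lapresteBound_diag`). Conversely such a bound yields such a factorization with
the same A (`LapresteBound.exists_factorization`). This is a Pietsch–Kwapień domination argument:
Hahn–Banach separation produces probability weights, and homogeneity turns an additive estimate into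
a product.

Matrices and functions are linked by `StepFamily`. Normalised indicators of disjoint sets span
isometric copies of ℓ_s in L^s, and the averaging projections of L¹ are contractions approximating
the identity on any finite set. As u_φ is continuous, it suffices to estimate its pairing with
averaged tensors (`enorm_opPairing_le_of_proj`). Every estimate preserves the constant, so the two
notions have the same admissible C. -/

theorem enorm_integral_ofReal {α : Type*} [MeasurableSpace α] {μ : Measure α} {g : α → ℝ}
    (hg : Integrable g μ) (h0 : 0 ≤ g) :
    ‖∫ x, (g x : ℂ) ∂μ‖ₑ = ∫⁻ x, ENNReal.ofReal (g x) ∂μ := by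
  rw [integral_complex_ofReal, ← ofReal_integral_eq_lintegral_ofReal hg (.of_forall h0),
    ← ofReal_norm]
  congr 1
  simp [abs_of_nonneg (integral_nonneg h0)]

theorem mul_conj_rpow {z : ℂ} {s : ℝ} (hs : s ≠ 0) :
    z * (starRingEnd ℂ z * ((‖z‖ ^ (s - 2) : ℝ) : ℂ)) = ((‖z‖ ^ s : ℝ) : ℂ) := by
  rcases eq_or_ne z 0 with rfl | hz
  · simp [Real.zero_rpow hs]
  · have : 0 < ‖z‖ := norm_pos_iff.2 hz
    rw [← mul_assoc, Complex.mul_conj, Complex.normSq_eq_norm_sq, ← Complex.ofReal_mul,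
      Real.rpow_sub this, Real.rpow_two]
    congr 1
    field_simp

theorem enorm_conj_rpow {z : ℂ} {s : ℝ} (hs : 1 < s) :
    ‖starRingEnd ℂ z * ((‖z‖ ^ (s - 2) : ℝ) : ℂ)‖ₑ = ‖z‖ₑ ^ (s - 1) := by
  rcases eq_or_ne z 0 with rfl | hz
  · simp [hs]
  · have : 0 < ‖z‖ := norm_pos_iff.2 hz
    rw [← ofReal_norm, ← ofReal_norm, ENNReal.ofReal_rpow_of_pos this]
    congr 1
    rw [norm_mul, RCLike.norm_conj, Complex.norm_real, Real.norm_of_nonneg (by positivity),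
      Real.rpow_sub this, Real.rpow_sub this, Real.rpow_two, Real.rpow_one]
    field_simp

theorem norm_conj_rpow_one_le (z : ℂ) :
    ‖starRingEnd ℂ z * ((‖z‖ ^ ((1 : ℝ) - 2) : ℝ) : ℂ)‖ ≤ 1 := by
  rcases eq_or_ne z 0 with rfl | hz
  · simp
  · have : 0 < ‖z‖ := norm_pos_iff.2 hz
    rw [norm_mul, RCLike.norm_conj, Complex.norm_real, Real.norm_of_nonneg (by positivity)]
    norm_num [Real.rpow_neg_one, this.ne']

/-- For finite p the test function is conj(f)|f|^{p-2}. Membership of f in L^p makes I = ∫ |f|^p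
finite, so I^{1/q} can be cancelled at the end. Semifiniteness is needed only for p = ∞, where the
test function must be cut down to an integrable one. -/
theorem eLpNorm_le_of_forall_integral_mul_le {α : Type*} [MeasurableSpace α] {μ : Measure α}
    (hsf : ∀ E, MeasurableSet E → μ E ≠ 0 → ∃ F ⊆ E, MeasurableSet F ∧ 0 < μ F ∧ μ F < ∞)
    {p q : ℝ≥0∞} [hpq : ENNReal.HolderConjugate p q] {f : α → ℂ} (hfm : StronglyMeasurable f)
    (hf : MemLp f p μ) {D : ℝ≥0∞}
    (h : ∀ k, MemLp k q μ → ‖∫ x, f x * k x ∂μ‖ₑ ≤ D * eLpNorm k q μ) :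
    eLpNorm f p μ ≤ D := by
  have hp1 : 1 ≤ p := ENNReal.HolderConjugate.one_le p q
  -- Chosen so that f · k s = |f|^s for s ≠ 0, with modulus |f|^{s-1} off the zeros of f; s = 1 is
  -- the conjugate phase, which serves both endpoint cases.
  set k : ℝ → α → ℂ := fun s x => starRingEnd ℂ (f x) * ((‖f x‖ ^ (s - 2) : ℝ) : ℂ) with hk
  have hkm : ∀ s, Measurable (k s) := fun s => by
    have := hfm.measurable
    have h1 : Measurable fun x => ‖f x‖ ^ (s - 2) := this.norm.pow_const _
    exact (Complex.continuous_conj.measurable.comp this).mul (Complex.measurable_ofReal.comp h1)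
  have hfk : ∀ {s : ℝ}, s ≠ 0 → ∀ x, f x * k s x = ((‖f x‖ ^ s : ℝ) : ℂ) := fun hs x =>
    mul_conj_rpow hs
  rcases eq_or_ne p ∞ with rfl | hp
  · obtain rfl : q = 1 := (ENNReal.HolderConjugate.eq_top_iff_eq_one ∞ q).1 rfl
    rw [eLpNorm_exponent_top, eLpNormEssSup]
    refine essSup_le_of_ae_le _ ?_
    by_contra hne
    have hE : MeasurableSet {x | D < ‖f x‖ₑ} := measurableSet_lt measurable_const hfm.enorm
    have hE0 : μ {x | D < ‖f x‖ₑ} ≠ 0 := by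
      intro h0
      apply hne
      filter_upwards [measure_eq_zero_iff_ae_notMem.1 h0] with x hx
      exact not_lt.1 hx
    obtain ⟨F, hFE, hF, hF0, hFt⟩ := hsf _ hE hE0
    obtain ⟨y, hy⟩ := nonempty_of_measure_ne_zero hE0
    have hD : D ≠ ∞ := ne_top_of_lt hy
    have hbd : ∀ x, ‖k 1 x‖ ≤ 1 := fun x => norm_conj_rpow_one_le (f x)
    have : IsFiniteMeasure (μ.restrict F) := ⟨by simpa using hFt⟩
    have hkF : MemLp (F.indicator (k 1)) 1 μ := by
      rw [memLp_indicator_iff_restrict hF]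
      exact MemLp.of_bound (hkm 1).aestronglyMeasurable 1 (.of_forall hbd)
    have hn : eLpNorm (F.indicator (k 1)) 1 μ ≤ μ F := by
      rw [eLpNorm_indicator_eq_eLpNorm_restrict hF, eLpNorm_one_eq_lintegral_enorm]
      calc ∫⁻ x in F, ‖k 1 x‖ₑ ∂μ ≤ ∫⁻ x in F, 1 ∂μ := by
            refine lintegral_mono fun x => ?_
            rw [← ofReal_norm]
            exact ENNReal.ofReal_le_one.2 (hbd x)
        _ = μ F := by simp
    have hint : ∫ x, f x * F.indicator (k 1) x ∂μ = ∫ x in F, ((‖f x‖ : ℝ) : ℂ) ∂μ := by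
      rw [← integral_indicator hF]
      congr 1 with x
      by_cases hx : x ∈ F
      · simp [hx, hfk one_ne_zero]
      · simp [hx]
    have hfi : Integrable (fun x => ‖f x‖) (μ.restrict F) :=
      ((hf.restrict F).integrable le_top).norm
    have h1 := (h _ hkF).trans (mul_le_mul_right hn D)
    rw [hint, enorm_integral_ofReal hfi (fun x => norm_nonneg _)] at h1
    simp_rw [ofReal_norm] at h1
    have h2 : ∫⁻ x in F, D ∂μ < ∫⁻ x in F, ‖f x‖ₑ ∂μ := by
      refine setLIntegral_strict_mono hF hF0.ne' hfm.enorm ?_ ?_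
      · simp [ENNReal.mul_eq_top, hD, hFt.ne]
      · exact .of_forall fun x hx => hFE hx
    rw [setLIntegral_const] at h2
    exact absurd h1 (not_le.2 h2)
  have hs1 : 1 ≤ p.toReal := by
    rw [← ENNReal.toReal_one]
    exact ENNReal.toReal_mono hp hp1
  have hs0 : 0 < p.toReal := by linarith
  have hp0 : p ≠ 0 := ENNReal.HolderConjugate.ne_zero p q
  set I := ∫⁻ x, ‖f x‖ₑ ^ p.toReal ∂μ with hI
  have hIf : I ≠ ∞ := (lintegral_rpow_enorm_lt_top_of_eLpNorm_lt_top hp0 hp hf.2).ne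
  have hfi : Integrable (fun x => ‖f x‖ ^ p.toReal) μ := hf.integrable_norm_rpow hp0 hp
  have hint : ‖∫ x, f x * k p.toReal x ∂μ‖ₑ = I := by
    simp_rw [hfk hs0.ne']
    rw [enorm_integral_ofReal hfi fun x => by positivity]
    congr 1 with x
    rw [← ofReal_norm, ENNReal.ofReal_rpow_of_nonneg (norm_nonneg _) hs0.le]
  rcases eq_or_ne p 1 with rfl | hpne
  · obtain rfl : q = ∞ := ((ENNReal.HolderConjugate.eq_top_iff_eq_one q 1).2 rfl)
    have hbd : ∀ x, ‖k 1 x‖ ≤ 1 := fun x => norm_conj_rpow_one_le (f x)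
    have hmem : MemLp (k 1) ∞ μ :=
      memLp_top_of_bound (hkm 1).aestronglyMeasurable 1 (.of_forall hbd)
    have hn : eLpNorm (k 1) ∞ μ ≤ 1 := by
      rw [eLpNorm_exponent_top]
      simpa using eLpNormEssSup_le_of_ae_bound (.of_forall hbd : ∀ᵐ x ∂μ, ‖k 1 x‖ ≤ 1)
    have h1 := (h _ hmem).trans (mul_le_mul_right hn D)
    rw [ENNReal.toReal_one] at hint
    rw [hint, mul_one] at h1
    simpa [eLpNorm_one_eq_lintegral_enorm, hI] using h1
  have hs : 1 < p.toReal := by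
    refine lt_of_le_of_ne hs1 fun h => hpne ?_
    rw [← ENNReal.ofReal_toReal hp, ← h, ENNReal.ofReal_one]
  have hq : q ≠ ∞ := fun h =>
    hpne ((ENNReal.HolderConjugate.eq_top_iff_eq_one q p).1 h)
  have hq0 : q ≠ 0 := ENNReal.HolderConjugate.ne_zero q p
  have hconj : p.toReal.HolderConjugate q.toReal :=
    ENNReal.HolderConjugate.toReal_of_ne_top hp hq
  have hnorm : eLpNorm (k p.toReal) q μ = I ^ (1 / q.toReal) := by
    rw [eLpNorm_eq_lintegral_rpow_enorm_toReal hq0 hq]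
    congr 2 with x
    rw [hk, enorm_conj_rpow hs, ← ENNReal.rpow_mul, hconj.sub_one_mul_conj]
  have hmem : MemLp (k p.toReal) q μ := by
    refine ⟨(hkm _).aestronglyMeasurable, ?_⟩
    rw [hnorm]
    exact ENNReal.rpow_lt_top_of_nonneg (by have := hconj.symm.pos; positivity) hIf
  have h1 := h _ hmem
  rw [hint, hnorm] at h1
  rw [eLpNorm_eq_lintegral_rpow_enorm_toReal hp0 hp, ← hI]
  rcases eq_or_ne I 0 with hI0 | hI0
  · rw [hI0, ENNReal.zero_rpow_of_pos (by positivity)]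
    exact zero_le
  · have h2 : I = I ^ (1 / p.toReal) * I ^ (1 / q.toReal) := by
      rw [← ENNReal.rpow_add _ _ hI0 hIf, hconj.one_div_add_one_div, div_one, ENNReal.rpow_one]
    nth_rewrite 1 [h2] at h1
    refine (ENNReal.mul_le_mul_iff_left ?_ ?_).1 h1
    · simp [ENNReal.rpow_eq_zero_iff, hI0, hIf]
    · exact (ENNReal.rpow_lt_top_of_nonneg (by have := hconj.symm.pos; positivity) hIf).ne

/-! ### Finite `ℓ_s` norms -/

section Ell

variable {n m : ℕ}

theorem ellNorm_top (a : Fin n → ℂ) : ellNorm ∞ a = ⨆ i, ‖a i‖ₑ := by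
  rw [ellNorm, eLpNorm_exponent_top, eLpNormEssSup, essSup_count]

theorem ellNorm_eq_sum {s : ℝ≥0∞} (h0 : s ≠ 0) (h : s ≠ ∞) (a : Fin n → ℂ) :
    ellNorm s a = (∑ i, ‖a i‖ₑ ^ s.toReal) ^ (1 / s.toReal) := by
  rw [ellNorm, eLpNorm_eq_lintegral_rpow_enorm_toReal h0 h, lintegral_count, tsum_fintype]

theorem ellNorm_rpow {s : ℝ≥0∞} (h0 : s ≠ 0) (h : s ≠ ∞) (a : Fin n → ℂ) :
    ellNorm s a ^ s.toReal = ∑ i, ‖a i‖ₑ ^ s.toReal := by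
  rw [ellNorm_eq_sum h0 h, ← ENNReal.rpow_mul, one_div_mul_cancel (ENNReal.toReal_pos h0 h).ne',
    ENNReal.rpow_one]

theorem ellNorm_one (a : Fin n → ℂ) : ellNorm 1 a = ∑ i, ‖a i‖ₑ := by
  simp [ellNorm_eq_sum]

theorem ellNorm_lt_top (s : ℝ≥0∞) (a : Fin n → ℂ) : ellNorm s a < ∞ :=
  eLpNorm_count_lt_top_of_lt fun _ => by simp

theorem ellNorm_mono (s : ℝ≥0∞) {a b : Fin n → ℂ} (h : ∀ i, ‖a i‖ ≤ ‖b i‖) :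
    ellNorm s a ≤ ellNorm s b :=
  eLpNorm_mono h

theorem memLp_count (s : ℝ≥0∞) (a : Fin n → ℂ) : MemLp a s Measure.count :=
  ⟨(measurable_of_finite a).aestronglyMeasurable, ellNorm_lt_top s a⟩

theorem ellNorm_const_mul (s : ℝ≥0∞) (c : ℂ) (a : Fin n → ℂ) :
    ellNorm s (fun i => c * a i) = ‖c‖ₑ * ellNorm s a :=
  eLpNorm_const_smul c a s _

theorem ellNorm_mul_le {s t r : ℝ≥0∞} [ENNReal.HolderTriple s t r] (a b : Fin n → ℂ) :
    ellNorm r (fun i => a i * b i) ≤ ellNorm s a * ellNorm t b :=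
  by simpa using! (eLpNorm_le_eLpNorm_mul_eLpNorm_of_nnnorm (memLp_count s a).1
    (memLp_count t b).1 (fun x y => x * y) 1 (.of_forall fun _ => by simp) :
    eLpNorm (fun i => a i * b i) r Measure.count ≤ _)

theorem ellNorm_le_of_forall_sum_mul_le {s t : ℝ≥0∞} [ENNReal.HolderConjugate s t]
    (a : Fin n → ℂ) {D : ℝ≥0∞} (h : ∀ b, ‖∑ i, a i * b i‖ₑ ≤ D * ellNorm t b) :
    ellNorm s a ≤ D := by
  refine eLpNorm_le_of_forall_integral_mul_le (q := t) (fun E hE h0 => ⟨E, le_rfl, hE, ?_, ?_⟩)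
    (measurable_of_finite a).stronglyMeasurable (memLp_count s a) fun k _ => ?_
  · exact pos_iff_ne_zero.2 h0
  · exact Measure.count_apply_lt_top.2 E.toFinite
  · rw [integral_count]
    exact h k

end Ell

/-! ### A finite dimensional domination theorem -/

section Domination

/-- A finite dimensional minimax principle. -/
theorem exists_weights_of_forall_convexComb {ι J : Type*} [Fintype J] [Nonempty J]
    (f : ι → J → ℝ)
    (h : ∀ (N : ℕ) (t : Fin N → ℝ) (i : Fin N → ι), (∀ l, 0 ≤ t l) → ∑ l, t l = 1 →
      ∃ j, 0 ≤ ∑ l, t l * f (i l) j) :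
    ∃ π : J → ℝ, (∀ j, 0 ≤ π j) ∧ ∑ j, π j = 1 ∧ ∀ i, 0 ≤ ∑ j, π j * f i j := by
  classical
  rcases isEmpty_or_nonempty ι with hι | ⟨⟨i₀⟩⟩
  · refine ⟨fun _ => (Fintype.card J : ℝ)⁻¹, fun j => by positivity, ?_, fun i => isEmptyElim i⟩
    simp
  set s : Set (J → ℝ) := {v | ∀ j, v j < 0} with hs
  have hso : IsOpen s := by
    simp only [hs, Set.ofPred_forall]
    exact isOpen_iInter_of_finite fun j => isOpen_lt (continuous_apply j) continuous_const
  have hsc : Convex ℝ s := by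
    have : s = Set.univ.pi fun _ => Set.Iio 0 := by ext v; simp [hs]
    rw [this]
    exact convex_pi fun j _ => convex_Iio 0
  -- The hypothesis says precisely that no convex combination of the functions f i is negative in
  -- every coordinate.
  have hd : Disjoint s (convexHull ℝ (Set.range f)) := by
    rw [Set.disjoint_left]
    intro v hv hv'
    obtain ⟨κ, _, t, z, ht0, ht1, hz, rfl⟩ := mem_convexHull_iff_exists_fintype.1 hv'
    choose i hi using hz
    set e := Fintype.equivFin κ
    obtain ⟨j, hj⟩ := h (Fintype.card κ) (t ∘ e.symm) (i ∘ e.symm) (fun l => ht0 _)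
      (by rw [← ht1]; exact e.symm.sum_comp t)
    refine absurd (hv j) (not_lt.2 (hj.trans_eq ?_))
    rw [Finset.sum_apply, ← e.symm.sum_comp]
    exact Finset.sum_congr rfl fun l _ => by simp [hi]
  obtain ⟨φ, u, hφs, hφt⟩ := geometric_hahn_banach_open hsc hso (convex_convexHull ℝ _) hd
  set c : J → ℝ := fun j => φ (Pi.single j 1) with hc
  have hφ : ∀ v, φ v = ∑ j, c j * v j := by
    intro v
    conv_lhs => rw [← Finset.univ_sum_single v, map_sum]
    refine Finset.sum_congr rfl fun j _ => ?_
    rw [hc, mul_comm, ← smul_eq_mul, ← map_smul, ← Pi.single_smul, smul_eq_mul, mul_one]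
  -- The bound φ ≤ u on the closed negative orthant gives u ≥ 0 at the origin, and, along negative
  -- multiples of a basis vector, that no coefficient of φ is negative.
  have hle : ∀ v : J → ℝ, (∀ j, v j ≤ 0) → φ v ≤ u := by
    intro v hv
    have hcl : v ∈ closure s := by
      refine mem_closure_of_tendsto (b := Filter.atTop)
        (f := fun n : ℕ => fun j => v j - 1 / ((n : ℝ) + 1)) ?_ (.of_forall fun n j => ?_)
      · refine tendsto_pi_nhds.2 fun j => ?_
        simpa using tendsto_const_nhds.sub (tendsto_one_div_add_atTop_nhds_zero_nat (𝕜 := ℝ))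
      · have : 0 < 1 / ((n : ℝ) + 1) := by positivity
        have := hv j
        linarith
    exact le_on_closure (fun v hv => (hφs v hv).le) φ.continuous.continuousOn
      continuousOn_const hcl
  have hu : 0 ≤ u := by simpa using hle 0 fun _ => le_rfl
  have hc0 : ∀ j, 0 ≤ c j := by
    intro j
    by_contra hneg
    rw [not_le] at hneg
    have h1 := hle (Pi.single j ((u + 1) / c j)) fun k => by
      rcases eq_or_ne k j with rfl | hk
      · simpa using div_nonpos_of_nonneg_of_nonpos (by linarith) hneg.le
      · simp [hk]
    rw [hφ, Finset.sum_eq_single j (fun k _ hk => by simp [hk]) (by simp), Pi.single_eq_same,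
      mul_div_cancel₀ _ hneg.ne] at h1
    linarith
  -- Otherwise φ = 0, which contradicts the strict inequality on the open orthant. Hence the
  -- coefficients can be normalised to a probability.
  have hcs : 0 < ∑ j, c j := by
    refine lt_of_le_of_ne (Finset.sum_nonneg fun j _ => hc0 j) fun h0 => ?_
    have hz : ∀ v, φ v = 0 := by
      intro v
      rw [hφ]
      refine Finset.sum_eq_zero fun j hj => ?_
      rw [(Finset.sum_eq_zero_iff_of_nonneg fun j _ => hc0 j).1 h0.symm j hj, zero_mul]
    have h1 := hφs (fun _ => -1) fun _ => by norm_num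
    have h2 := hφt (f i₀) (subset_convexHull ℝ _ ⟨i₀, rfl⟩)
    rw [hz] at h1 h2
    linarith
  refine ⟨fun j => c j / ∑ k, c k, fun j => div_nonneg (hc0 j) hcs.le, ?_, fun i => ?_⟩
  · rw [← Finset.sum_div, div_self hcs.ne']
  · have h2 := hu.trans (hφt (f i) (subset_convexHull ℝ _ ⟨i, rfl⟩))
    rw [hφ] at h2
    simp_rw [div_mul_eq_mul_div]
    rw [← Finset.sum_div]
    exact div_nonneg h2 hcs.le

variable {m n : ℕ}

/-- The bilinear form of a matrix. -/
noncomputable def matForm (Z : Fin m → Fin n → ℂ) (x : Fin m → ℂ) (y : Fin n → ℂ) : ℂ :=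
  ∑ j, ∑ k, Z j k * (x j * y k)

theorem matForm_smul_smul (Z : Fin m → Fin n → ℂ) (c d : ℂ) (x : Fin m → ℂ) (y : Fin n → ℂ) :
    matForm Z (fun j => c * x j) (fun k => d * y k) = c * d * matForm Z x y := by
  simp_rw [matForm, Finset.mul_sum]
  exact Finset.sum_congr rfl fun j _ => Finset.sum_congr rfl fun k _ => by ring

theorem matForm_diag (t : Fin m → Fin n → ℂ) (a x : Fin m → ℂ) (b y : Fin n → ℂ) :
    matForm (fun j k => a j * b k * t j k) x y =
      matForm t (fun j => a j * x j) (fun k => b k * y k) := by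
  simp_rw [matForm]
  exact Finset.sum_congr rfl fun j _ => Finset.sum_congr rfl fun k _ => by ring

theorem matForm_single [DecidableEq (Fin m)] [DecidableEq (Fin n)] (Z : Fin m → Fin n → ℂ)
    (j : Fin m) (k : Fin n) : matForm Z (Pi.single j 1) (Pi.single k 1) = Z j k := by
  rw [matForm, Finset.sum_eq_single j (fun i _ hi => by simp [hi]) (by simp),
    Finset.sum_eq_single k (fun i _ hi => by simp [hi]) (by simp)]
  simp

/-- `A` bounds the pairing of the matrix `Z` with `ℓ_∞ ⊗ ℓ_∞`, the latter normed by a Lapresté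
norm: weak `ℓ_p` norms in `ℓ_∞` are suprema of `ℓ_p` norms of coordinates. -/
def LapresteBound (p s r : ℝ≥0∞) (Z : Fin m → Fin n → ℂ) (A : ℝ≥0∞) : Prop :=
  ∀ (N : ℕ) (c : Fin N → ℂ) (x : Fin N → Fin m → ℂ) (y : Fin N → Fin n → ℂ),
    ‖∑ i, c i * matForm Z (x i) (y i)‖ₑ ≤
      A * (ellNorm r c * (⨆ j, ellNorm p fun i => x i j) * ⨆ k, ellNorm s fun i => y i k)

/-- Interchanging the two sums in the ℓ_p(ℓ_p) norm leaves ∑_j |a_j|^p times a p-th power that the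
supremum over j bounds. -/
theorem ellNorm_ellNorm_mul_le {N : ℕ} {p : ℝ≥0∞} (hp : p ≠ 0) (a : Fin m → ℂ)
    (x : Fin N → Fin m → ℂ) :
    ellNorm p (fun i => ((ellNorm p fun j => a j * x i j).toReal : ℂ)) ≤
      ellNorm p a * ⨆ j, ellNorm p fun i => x i j := by
  have hen : ∀ i, ‖((ellNorm p fun j => a j * x i j).toReal : ℂ)‖ₑ =
      ellNorm p fun j => a j * x i j := fun i => by
    rw [← ofReal_norm, Complex.norm_real, Real.norm_of_nonneg ENNReal.toReal_nonneg,
      ENNReal.ofReal_toReal (ellNorm_lt_top _ _).ne]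
  rcases eq_or_ne p ∞ with rfl | hpt
  · rw [ellNorm_top]
    refine iSup_le fun i => ?_
    rw [hen, ellNorm_top]
    refine iSup_le fun j => ?_
    rw [enorm_mul]
    refine mul_le_mul' ?_ (le_trans ?_ (le_iSup _ j))
    · rw [ellNorm_top]
      exact le_iSup (fun j => ‖a j‖ₑ) j
    · rw [ellNorm_top]
      exact le_iSup (fun i => ‖x i j‖ₑ) i
  · have hp' := ENNReal.toReal_pos hp hpt
    rw [← ENNReal.rpow_le_rpow_iff hp', ENNReal.mul_rpow_of_nonneg _ _ hp'.le,
      ellNorm_rpow hp hpt, ellNorm_rpow hp hpt, Finset.sum_mul]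
    simp_rw [hen, ellNorm_rpow hp hpt]
    rw [Finset.sum_comm]
    refine Finset.sum_le_sum fun j _ => ?_
    simp_rw [enorm_mul, ENNReal.mul_rpow_of_nonneg _ _ hp'.le]
    rw [← Finset.mul_sum, ← ellNorm_rpow hp hpt fun i => x i j]
    gcongr
    exact le_iSup (fun j => ellNorm p fun i => x i j) j

/-- The easy half of the factorization. The diagonals are moved onto x_i and y_i, t is estimated
term by term, and Hölder is applied twice, with 1 = 1/r + 1/ρ and 1/ρ = 1/p + 1/s. -/
theorem lapresteBound_diag {p s r ρ : ℝ≥0∞} [ENNReal.HolderTriple p s ρ]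
    [ENNReal.HolderConjugate r ρ] (hp : p ≠ 0) (hs : s ≠ 0) {t : Fin m → Fin n → ℂ} {A : ℝ≥0∞}
    (ht : ∀ a b, ‖matForm t a b‖ₑ ≤ A * (ellNorm p a * ellNorm s b))
    (a : Fin m → ℂ) (b : Fin n → ℂ) :
    LapresteBound p s r (fun j k => a j * b k * t j k) (A * (ellNorm p a * ellNorm s b)) := by
  intro N c x y
  set X : Fin N → ℂ := fun i => ((ellNorm p fun j => a j * x i j).toReal : ℂ) with hX
  set Y : Fin N → ℂ := fun i => ((ellNorm s fun k => b k * y i k).toReal : ℂ) with hY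
  have hXn : ∀ i, ‖X i‖ₑ = ellNorm p fun j => a j * x i j := fun i => by
    rw [← ofReal_norm, Complex.norm_real, Real.norm_of_nonneg ENNReal.toReal_nonneg,
      ENNReal.ofReal_toReal (ellNorm_lt_top _ _).ne]
  have hYn : ∀ i, ‖Y i‖ₑ = ellNorm s fun k => b k * y i k := fun i => by
    rw [← ofReal_norm, Complex.norm_real, Real.norm_of_nonneg ENNReal.toReal_nonneg,
      ENNReal.ofReal_toReal (ellNorm_lt_top _ _).ne]
  calc ‖∑ i, c i * matForm (fun j k => a j * b k * t j k) (x i) (y i)‖ₑ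
      ≤ ∑ i, ‖c i * matForm (fun j k => a j * b k * t j k) (x i) (y i)‖ₑ := enorm_sum_le _ _
    _ ≤ ∑ i, A * ‖c i * (X i * Y i)‖ₑ := by
        refine Finset.sum_le_sum fun i _ => ?_
        rw [enorm_mul, enorm_mul, enorm_mul, hXn, hYn, matForm_diag, mul_left_comm]
        gcongr
        exact ht _ _
    _ = A * ellNorm 1 (fun i => c i * (X i * Y i)) := by rw [← Finset.mul_sum, ellNorm_one]
    _ ≤ A * (ellNorm r c * (ellNorm p X * ellNorm s Y)) := by
        gcongr
        exact (ellNorm_mul_le (s := r) (t := ρ) _ _).trans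
          (mul_le_mul_right (ellNorm_mul_le (s := p) (t := s) _ _) _)
    _ ≤ A * (ellNorm r c * ((ellNorm p a * ⨆ j, ellNorm p fun i => x i j) *
          (ellNorm s b * ⨆ k, ellNorm s fun i => y i k))) := by
        gcongr
        · exact ellNorm_ellNorm_mul_le hp a x
        · exact ellNorm_ellNorm_mul_le hs b y
    _ = _ := by ring

/-- The scalars c run through ℓ_r, the dual of ℓ_ρ, so they can be removed by duality. -/
theorem LapresteBound.ellNorm_le {p s r ρ : ℝ≥0∞} [ENNReal.HolderConjugate ρ r]
    {Z : Fin m → Fin n → ℂ} {A : ℝ≥0∞} (h : LapresteBound p s r Z A) {N : ℕ}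
    (x : Fin N → Fin m → ℂ) (y : Fin N → Fin n → ℂ) :
    ellNorm ρ (fun i => matForm Z (x i) (y i)) ≤
      A * ((⨆ j, ellNorm p fun i => x i j) * ⨆ k, ellNorm s fun i => y i k) := by
  refine ellNorm_le_of_forall_sum_mul_le (t := r) _ fun c => ?_
  refine le_trans (le_of_eq ?_) ((h N c x y).trans (le_of_eq (by ring)))
  simp_rw [mul_comm]

/-- The weights `w_j^{1/p}` form a unit vector of `ℓ_p`. -/
theorem ellNorm_rpow_weights_le {p : ℝ≥0∞} (hp : p ≠ 0) {w : Fin m → ℝ} (hw : ∀ j, 0 ≤ w j)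
    (hw1 : ∑ j, w j ≤ 1) : ellNorm p (fun j => ((w j ^ p⁻¹.toReal : ℝ) : ℂ)) ≤ 1 := by
  rcases eq_or_ne p ∞ with rfl | hpt
  · rw [ellNorm_top]
    exact iSup_le fun j => by simp
  · have hp' := ENNReal.toReal_pos hp hpt
    rw [← ENNReal.rpow_le_rpow_iff hp', ellNorm_rpow hp hpt, ENNReal.one_rpow]
    calc _ = ∑ j, ENNReal.ofReal (w j) := by
          refine Finset.sum_congr rfl fun j _ => ?_
          rw [← ofReal_norm, Complex.norm_real, Real.norm_of_nonneg (Real.rpow_nonneg (hw j) _),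
            ENNReal.ofReal_rpow_of_nonneg (Real.rpow_nonneg (hw j) _) hp'.le,
            ← Real.rpow_mul (hw j), ENNReal.toReal_inv, inv_mul_cancel₀ hp'.ne', Real.rpow_one]
      _ = ENNReal.ofReal (∑ j, w j) := (ENNReal.ofReal_sum_of_nonneg fun j _ => hw j).symm
      _ ≤ 1 := ENNReal.ofReal_le_one.2 hw1

/-- The factor p⁻¹ gives all exponents one form: at p = ∞ it makes the first claim empty, and the
constraint is carried by the second. -/
theorem sum_weights_le_of_ellNorm_le_one {p : ℝ≥0∞} (hp : p ≠ 0) {w : Fin m → ℝ}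
    (hw : ∀ j, 0 ≤ w j) {x : Fin m → ℂ}
    (hx : ellNorm p (fun j => ((w j ^ p⁻¹.toReal : ℝ) : ℂ) * x j) ≤ 1) :
    p⁻¹.toReal * ∑ j, w j * ‖x j‖ ^ p.toReal ≤ p⁻¹.toReal ∧ (p = ∞ → ∀ j, ‖x j‖ ≤ 1) := by
  rcases eq_or_ne p ∞ with rfl | hpt
  · refine ⟨by simp, fun _ j => ?_⟩
    rw [ellNorm_top] at hx
    have := (le_iSup (fun j => ‖((w j ^ (∞ : ℝ≥0∞)⁻¹.toReal : ℝ) : ℂ) * x j‖ₑ) j).trans hx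
    simpa [← ofReal_norm] using this
  · refine ⟨mul_le_of_le_one_right ENNReal.toReal_nonneg ?_, fun h => absurd h hpt⟩
    have hp' := ENNReal.toReal_pos hp hpt
    rw [← ENNReal.rpow_le_rpow_iff hp', ellNorm_rpow hp hpt, ENNReal.one_rpow] at hx
    rw [← ENNReal.ofReal_le_one]
    rw [ENNReal.ofReal_sum_of_nonneg fun j _ => mul_nonneg (hw j) (by positivity)]
    refine le_trans (le_of_eq (Finset.sum_congr rfl fun j _ => ?_)) hx
    rw [← ofReal_norm, norm_mul, Complex.norm_real,
      Real.norm_of_nonneg (Real.rpow_nonneg (hw j) _),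
      ENNReal.ofReal_rpow_of_nonneg (mul_nonneg (Real.rpow_nonneg (hw j) _) (norm_nonneg _)) hp'.le,
      Real.mul_rpow (Real.rpow_nonneg (hw j) _) (norm_nonneg _),
      ← Real.rpow_mul (hw j), ENNReal.toReal_inv, inv_mul_cancel₀ hp'.ne', Real.rpow_one]

/-- Weighted `ℓ_p` norms; for `p = ∞` the right hand side is `1`. -/
theorem ellNorm_rpow_smul_le {N : ℕ} {p : ℝ≥0∞} (hp : p ≠ 0) {t : Fin N → ℝ} (ht : ∀ l, 0 ≤ t l)
    (x : Fin N → ℂ) (hx : p = ∞ → ∀ l, ‖x l‖ ≤ 1) :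
    ellNorm p (fun l => ((t l ^ p⁻¹.toReal : ℝ) : ℂ) * x l) ≤
      ENNReal.ofReal ((∑ l, t l * ‖x l‖ ^ p.toReal) ^ p⁻¹.toReal) := by
  rcases eq_or_ne p ∞ with rfl | hpt
  · rw [ellNorm_top]
    refine iSup_le fun l => ?_
    simpa [← ofReal_norm] using hx rfl l
  · have hp' := ENNReal.toReal_pos hp hpt
    have h0 : 0 ≤ ∑ l, t l * ‖x l‖ ^ p.toReal :=
      Finset.sum_nonneg fun l _ => mul_nonneg (ht l) (by positivity)
    rw [← ENNReal.rpow_le_rpow_iff hp', ellNorm_rpow hp hpt,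
      ENNReal.ofReal_rpow_of_nonneg (Real.rpow_nonneg h0 _) hp'.le, ← Real.rpow_mul h0,
      ENNReal.toReal_inv, inv_mul_cancel₀ hp'.ne', Real.rpow_one,
      ENNReal.ofReal_sum_of_nonneg fun l _ => mul_nonneg (ht l) (by positivity)]
    refine Finset.sum_le_sum fun l _ => le_of_eq ?_
    rw [← ofReal_norm, norm_mul, Complex.norm_real,
      Real.norm_of_nonneg (Real.rpow_nonneg (ht l) _),
      ENNReal.ofReal_rpow_of_nonneg (mul_nonneg (Real.rpow_nonneg (ht l) _) (norm_nonneg _)) hp'.le,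
      Real.mul_rpow (Real.rpow_nonneg (ht l) _) (norm_nonneg _),
      ← Real.rpow_mul (ht l), inv_mul_cancel₀ hp'.ne', Real.rpow_one]

end Domination

/-! ### Domination by weights and factorization of matrices -/

section Domination

variable {m n : ℕ}

/-- The additive form of domination: the minimax principle is applied on pairs (j, k) to the
difference of the two sides with point masses as weights. At p = ∞ the x-term carries the factor 0
and the restriction |x_j| ≤ 1 replaces it; likewise for s. -/
theorem LapresteBound.exists_weights [NeZero m] [NeZero n] {p s r ρ : ℝ≥0∞} (hp : p ≠ 0)
    (hs : s ≠ 0) (hρ : ρ ≠ ∞) [ENNReal.HolderTriple p s ρ] [ENNReal.HolderConjugate ρ r]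
    {Z : Fin m → Fin n → ℂ} {a : ℝ≥0} (h : LapresteBound p s r Z a) :
    ∃ (w : Fin m → ℝ) (v : Fin n → ℝ), (∀ j, 0 ≤ w j) ∧ ∑ j, w j = 1 ∧ (∀ k, 0 ≤ v k) ∧
      ∑ k, v k = 1 ∧ ∀ x y, (p = ∞ → ∀ j, ‖x j‖ ≤ 1) → (s = ∞ → ∀ k, ‖y k‖ ≤ 1) →
        ‖matForm Z x y‖ ^ ρ.toReal ≤ (a : ℝ) ^ ρ.toReal * (ρ.toReal *
          (p⁻¹.toReal * ∑ j, w j * ‖x j‖ ^ p.toReal +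
            s⁻¹.toReal * ∑ k, v k * ‖y k‖ ^ s.toReal)) := by
  have hρ0 : ρ ≠ 0 := ENNReal.HolderConjugate.ne_zero ρ r
  have hρ' := ENNReal.toReal_pos hρ0 hρ
  set P := p⁻¹.toReal with hP
  set S := s⁻¹.toReal with hS
  set R := ρ.toReal with hR
  have hP0 : 0 ≤ P := ENNReal.toReal_nonneg
  have hS0 : 0 ≤ S := ENNReal.toReal_nonneg
  have hPS : P + S = R⁻¹ := by
    rw [hP, hS, hR, ← ENNReal.toReal_inv, ← ENNReal.HolderTriple.inv_add_inv_eq_inv p s ρ,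
      ENNReal.toReal_add (by simpa using hp) (by simpa using hs)]
  have hsum : R * P + R * S = 1 := by rw [← mul_add, hPS, mul_inv_cancel₀ hρ'.ne']
  let ι := {z : (Fin m → ℂ) × (Fin n → ℂ) //
    (p = ∞ → ∀ j, ‖z.1 j‖ ≤ 1) ∧ (s = ∞ → ∀ k, ‖z.2 k‖ ≤ 1)}
  let f : ι → Fin m × Fin n → ℝ := fun z jk =>
    (a : ℝ) ^ R * (R * P * ‖z.1.1 jk.1‖ ^ p.toReal + R * S * ‖z.1.2 jk.2‖ ^ s.toReal) -
      ‖matForm Z z.1.1 z.1.2‖ ^ R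
  obtain ⟨π, hπ0, hπ1, hπ⟩ := exists_weights_of_forall_convexComb f (by
    intro N t i ht0 ht1
    set x : Fin N → Fin m → ℂ := fun l => (i l).1.1
    set y : Fin N → Fin n → ℂ := fun l => (i l).1.2
    -- A convex combination is tested at the coordinates j and k where the weighted weak norms
    -- attain their maxima, which are the suprema in `LapresteBound`.
    obtain ⟨j, hj⟩ := Finite.exists_max fun j =>
      ellNorm p fun l => ((t l ^ P : ℝ) : ℂ) * x l j
    obtain ⟨k, hk⟩ := Finite.exists_max fun k =>
      ellNorm s fun l => ((t l ^ S : ℝ) : ℂ) * y l k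
    refine ⟨(j, k), ?_⟩
    set X := ∑ l, t l * ‖x l j‖ ^ p.toReal with hX
    set Y := ∑ l, t l * ‖y l k‖ ^ s.toReal with hY
    have hX0 : 0 ≤ X := Finset.sum_nonneg fun l _ => mul_nonneg (ht0 l) (by positivity)
    have hY0 : 0 ≤ Y := Finset.sum_nonneg fun l _ => mul_nonneg (ht0 l) (by positivity)
    have h1 := h.ellNorm_le (ρ := ρ) (fun l j => ((t l ^ P : ℝ) : ℂ) * x l j)
      (fun l k => ((t l ^ S : ℝ) : ℂ) * y l k)
    have h2 : ellNorm ρ (fun l => matForm Z (fun j => ((t l ^ P : ℝ) : ℂ) * x l j)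
        (fun k => ((t l ^ S : ℝ) : ℂ) * y l k)) ≤
        ENNReal.ofReal (a * (X ^ P * Y ^ S)) := by
      refine h1.trans ?_
      rw [ENNReal.ofReal_mul a.coe_nonneg, ENNReal.ofReal_mul (by positivity)]
      refine mul_le_mul' (by simp) (mul_le_mul' (iSup_le fun j' => (hj j').trans ?_)
        (iSup_le fun k' => (hk k').trans ?_))
      · exact ellNorm_rpow_smul_le hp ht0 _ fun hp l => (i l).2.1 hp j
      · exact ellNorm_rpow_smul_le hs ht0 _ fun hs l => (i l).2.2 hs k
    rw [← ENNReal.rpow_le_rpow_iff hρ', ellNorm_rpow hρ0 hρ,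
      ENNReal.ofReal_rpow_of_nonneg (by positivity) hρ'.le] at h2
    -- The scalings t_l^{1/p} and t_l^{1/s} multiply to t_l^{1/ρ}, whose ρ-th power is the convex
    -- weight t_l.
    have h3 : ∑ l, t l * ‖matForm Z (x l) (y l)‖ ^ R ≤ (a * (X ^ P * Y ^ S)) ^ R := by
      rw [← ENNReal.ofReal_le_ofReal_iff (by positivity),
        ENNReal.ofReal_sum_of_nonneg fun l _ => mul_nonneg (ht0 l) (by positivity)]
      refine le_trans (le_of_eq (Finset.sum_congr rfl fun l _ => ?_)) h2
      rw [matForm_smul_smul, ← ofReal_norm, ENNReal.ofReal_rpow_of_nonneg (norm_nonneg _) hρ'.le,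
        norm_mul, norm_mul, Complex.norm_real, Complex.norm_real,
        Real.norm_of_nonneg (Real.rpow_nonneg (ht0 l) _),
        Real.norm_of_nonneg (Real.rpow_nonneg (ht0 l) _),
        ← Real.rpow_add_of_nonneg (ht0 l) hP0 hS0, hPS,
        Real.mul_rpow (Real.rpow_nonneg (ht0 l) _) (norm_nonneg _), ← Real.rpow_mul (ht0 l),
        inv_mul_cancel₀ hρ'.ne', Real.rpow_one]
    have h4 : (a * (X ^ P * Y ^ S)) ^ R ≤ (a : ℝ) ^ R * (R * P * X + R * S * Y) := by
      rw [Real.mul_rpow a.coe_nonneg (by positivity), Real.mul_rpow (by positivity) (by positivity),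
        ← Real.rpow_mul hX0, ← Real.rpow_mul hY0, mul_comm P, mul_comm S]
      gcongr
      exact Real.geom_mean_le_arith_mean2_weighted (by positivity) (by positivity) hX0 hY0 hsum
    have h5 : ∑ l, t l * f (i l) (j, k) =
        (a : ℝ) ^ R * (R * P * X + R * S * Y) - ∑ l, t l * ‖matForm Z (x l) (y l)‖ ^ R := by
      rw [hX, hY, Finset.mul_sum, Finset.mul_sum, ← Finset.sum_add_distrib, Finset.mul_sum,
        ← Finset.sum_sub_distrib]
      exact Finset.sum_congr rfl fun l _ => by simp only [f, x, y]; ring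
    rw [h5]
    linarith)
  -- Each term depends on j alone or on k alone, so only the marginals of π matter.
  refine ⟨fun j => ∑ k, π (j, k), fun k => ∑ j, π (j, k), fun j => Finset.sum_nonneg fun k _ =>
    hπ0 _, by rw [← hπ1, Fintype.sum_prod_type], fun k => Finset.sum_nonneg fun j _ => hπ0 _,
    by rw [← hπ1, Fintype.sum_prod_type_right], fun x y hx hy => ?_⟩
  have h1 := hπ ⟨(x, y), hx, hy⟩
  have h2 : ∑ jk, π jk * f ⟨(x, y), hx, hy⟩ jk = (a : ℝ) ^ R * (R *
      (P * ∑ j, (∑ k, π (j, k)) * ‖x j‖ ^ p.toReal +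
        S * ∑ k, (∑ j, π (j, k)) * ‖y k‖ ^ s.toReal)) - ‖matForm Z x y‖ ^ R := by
    have e1 : ∑ j, (∑ k, π (j, k)) * ‖x j‖ ^ p.toReal = ∑ jk, π jk * ‖x jk.1‖ ^ p.toReal := by
      rw [Fintype.sum_prod_type]
      simp_rw [Finset.sum_mul]
    have e2 : ∑ k, (∑ j, π (j, k)) * ‖y k‖ ^ s.toReal = ∑ jk, π jk * ‖y jk.2‖ ^ s.toReal := by
      rw [Fintype.sum_prod_type_right]
      simp_rw [Finset.sum_mul]
    rw [e1, e2]
    conv_rhs => rw [← one_mul (‖matForm Z x y‖ ^ R), ← hπ1]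
    rw [Finset.mul_sum, Finset.mul_sum, ← Finset.sum_add_distrib, Finset.mul_sum, Finset.mul_sum,
      Finset.sum_mul, ← Finset.sum_sub_distrib]
    exact Finset.sum_congr rfl fun jk _ => by simp only [f]; ring
  linarith [h2 ▸ h1]

/-- The additive estimate becomes a product by homogeneity: x and y are scaled to weighted norm at
most 1, where the additive right-hand side is at most A^ρ because 1/p + 1/s = 1/ρ. If ρ = ∞ then p =
s = ∞, and the case N = 1 of the hypothesis already suffices. -/
theorem LapresteBound.exists_domination {p s r ρ : ℝ≥0∞} (hp : p ≠ 0)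
    (hs : s ≠ 0) [ENNReal.HolderTriple p s ρ] [ENNReal.HolderConjugate ρ r]
    {Z : Fin m → Fin n → ℂ} {A : ℝ≥0∞} (hA : A ≠ ∞) (h : LapresteBound p s r Z A) :
    ∃ (α : Fin m → ℂ) (β : Fin n → ℂ), ellNorm p α ≤ 1 ∧ ellNorm s β ≤ 1 ∧ ∀ x y,
      ‖matForm Z x y‖ₑ ≤
        A * (ellNorm p (fun j => α j * x j) * ellNorm s fun k => β k * y k) := by
  lift A to ℝ≥0 using hA with a
  rcases Nat.eq_zero_or_pos m with rfl | hm
  · exact ⟨0, 0, by simp [ellNorm], by simp [ellNorm], fun x y => by simp [matForm]⟩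
  rcases Nat.eq_zero_or_pos n with rfl | hn
  · exact ⟨0, 0, by simp [ellNorm], by simp [ellNorm], fun x y => by simp [matForm]⟩
  have : NeZero m := ⟨hm.ne'⟩
  have : NeZero n := ⟨hn.ne'⟩
  have hρ0 : ρ ≠ 0 := ENNReal.HolderConjugate.ne_zero ρ r
  rcases eq_or_ne ρ ∞ with rfl | hρ
  · have hinv := ENNReal.HolderTriple.inv_add_inv_eq_inv p s ∞
    simp only [ENNReal.inv_top, add_eq_zero, ENNReal.inv_eq_zero] at hinv
    obtain ⟨rfl, rfl⟩ := hinv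
    refine ⟨fun _ => 1, fun _ => 1, by simp [ellNorm_top], by simp [ellNorm_top], fun x y => ?_⟩
    have h1 := h.ellNorm_le (N := 1) (ρ := ∞) (fun _ => x) (fun _ => y)
    simpa [ellNorm_top] using h1
  have hρ' := ENNReal.toReal_pos hρ0 hρ
  obtain ⟨w, v, hw, hw1, hv, hv1, hwv⟩ := h.exists_weights hp hs hρ
  have hPS : p⁻¹.toReal + s⁻¹.toReal = ρ.toReal⁻¹ := by
    rw [← ENNReal.toReal_inv, ← ENNReal.HolderTriple.inv_add_inv_eq_inv p s ρ,
      ENNReal.toReal_add (by simpa using hp) (by simpa using hs)]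
  refine ⟨fun j => ((w j ^ p⁻¹.toReal : ℝ) : ℂ), fun k => ((v k ^ s⁻¹.toReal : ℝ) : ℂ),
    ellNorm_rpow_weights_le hp hw hw1.le, ellNorm_rpow_weights_le hs hv hv1.le, fun x y => ?_⟩
  set X := ellNorm p fun j => ((w j ^ p⁻¹.toReal : ℝ) : ℂ) * x j with hX
  set Y := ellNorm s fun k => ((v k ^ s⁻¹.toReal : ℝ) : ℂ) * y k with hY
  have hXt : X ≠ ∞ := (ellNorm_lt_top _ _).ne
  have hYt : Y ≠ ∞ := (ellNorm_lt_top _ _).ne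
  -- The weights may vanish, so X or Y can be 0 for nonzero vectors; ε keeps the scaling invertible.
  have key : ∀ ε : ℝ, 0 < ε → ‖matForm Z x y‖ ≤ a * ((X.toReal + ε) * (Y.toReal + ε)) := by
    intro ε hε
    have scale : ∀ {l : ℕ} {e : ℝ≥0∞} (γ z : Fin l → ℂ), ellNorm e (fun j => γ j * z j) ≠ ∞ →
        ellNorm e (fun j => γ j * ((((ellNorm e fun j => γ j * z j).toReal + ε)⁻¹ : ℝ) * z j))
          ≤ 1 := by
      intro l e γ z hfin
      set W := ellNorm e fun j => γ j * z j with hW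
      have hpos : 0 < W.toReal + ε := by positivity
      have hcomm : (fun j => γ j * (((W.toReal + ε)⁻¹ : ℝ) * z j)) =
          fun j => (((W.toReal + ε)⁻¹ : ℝ) : ℂ) * (γ j * z j) := by
        ext j
        ring
      rw [hcomm, ellNorm_const_mul, ← hW, ← ofReal_norm, Complex.norm_real,
        Real.norm_of_nonneg (inv_nonneg.2 hpos.le)]
      nth_rewrite 2 [← ENNReal.ofReal_toReal hfin]
      rw [← ENNReal.ofReal_mul (inv_nonneg.2 hpos.le), ENNReal.ofReal_le_one, inv_mul_le_iff₀ hpos]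
      linarith
    obtain ⟨hx1, hx2⟩ := sum_weights_le_of_ellNorm_le_one hp hw (scale _ _ hXt)
    obtain ⟨hy1, hy2⟩ := sum_weights_le_of_ellNorm_le_one hs hv (scale _ _ hYt)
    rw [← hX] at hx1 hx2
    rw [← hY] at hy1 hy2
    have h1 := hwv _ _ hx2 hy2
    have h2 : ‖matForm Z (fun j => (((X.toReal + ε)⁻¹ : ℝ) : ℂ) * x j)
        (fun k => (((Y.toReal + ε)⁻¹ : ℝ) : ℂ) * y k)‖ ^ ρ.toReal ≤ (a : ℝ) ^ ρ.toReal := by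
      refine h1.trans (mul_le_of_le_one_right (by positivity) ?_)
      refine (mul_le_mul_of_nonneg_left (add_le_add hx1 hy1) hρ'.le).trans_eq ?_
      rw [hPS, mul_inv_cancel₀ hρ'.ne']
    have h3 := (Real.rpow_le_rpow_iff (norm_nonneg _) a.coe_nonneg hρ').1 h2
    have hXp : 0 < X.toReal + ε := by positivity
    have hYp : 0 < Y.toReal + ε := by positivity
    rw [matForm_smul_smul, norm_mul, norm_mul, Complex.norm_real, Complex.norm_real,
      Real.norm_of_nonneg (inv_nonneg.2 hXp.le), Real.norm_of_nonneg (inv_nonneg.2 hYp.le),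
      ← mul_inv, inv_mul_le_iff₀ (by positivity), mul_comm _ (a : ℝ)] at h3
    exact h3
  have hlim : ‖matForm Z x y‖ ≤ a * (X.toReal * Y.toReal) := by
    have ht : Filter.Tendsto (fun ε : ℝ => (a : ℝ) * ((X.toReal + ε) * (Y.toReal + ε)))
        (nhdsWithin 0 (Set.Ioi 0)) (nhds (a * ((X.toReal + 0) * (Y.toReal + 0)))) := by
      refine Filter.Tendsto.mono_left ?_ nhdsWithin_le_nhds
      exact Continuous.tendsto (by fun_prop) 0
    rw [add_zero, add_zero] at ht
    exact ge_of_tendsto ht (by filter_upwards [self_mem_nhdsWithin] with ε hε using key ε hε)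
  rw [← ofReal_norm, ← ENNReal.ofReal_toReal hXt, ← ENNReal.ofReal_toReal hYt,
    ← ENNReal.ofReal_mul ENNReal.toReal_nonneg, ← ENNReal.ofReal_coe_nnreal,
    ← ENNReal.ofReal_mul a.coe_nonneg]
  exact ENNReal.ofReal_le_ofReal hlim

/-- A matrix whose bilinear form is bounded on `ℓ_∞ ⊗ ℓ_∞` by the dual Lapresté norm factors
through diagonal operators. -/
theorem LapresteBound.exists_factorization {p s r ρ : ℝ≥0∞} (hp : p ≠ 0)
    (hs : s ≠ 0) [ENNReal.HolderTriple p s ρ] [ENNReal.HolderConjugate ρ r]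
    {Z : Fin m → Fin n → ℂ} {A : ℝ≥0∞} (hA : A ≠ ∞) (h : LapresteBound p s r Z A) :
    ∃ (α : Fin m → ℂ) (β : Fin n → ℂ) (t : Fin m → Fin n → ℂ), ellNorm p α ≤ 1 ∧
      ellNorm s β ≤ 1 ∧ (∀ j k, Z j k = α j * β k * t j k) ∧
      ∀ x y, ‖matForm t x y‖ₑ ≤ A * (ellNorm p x * ellNorm s y) := by
  classical
  obtain ⟨α, β, hα, hβ, hαβ⟩ := h.exists_domination hp hs hA (ρ := ρ)
  -- With 0⁻¹ = 0 the quotient is legitimate: domination at unit vectors forces Z j k = 0 wherever α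
  -- j or β k vanishes. In the bound for t, the products α α⁻¹ and β β⁻¹ are 0 or 1, so they only
  -- shrink x and y.
  refine ⟨α, β, fun j k => (α j)⁻¹ * (β k)⁻¹ * Z j k, hα, hβ, fun j k => ?_, fun x y => ?_⟩
  · by_cases h0 : α j = 0 ∨ β k = 0
    · have hz : Z j k = 0 := by
        rw [← matForm_single Z j k, ← enorm_eq_zero, ← le_zero_iff]
        refine (hαβ _ _).trans ?_
        rcases h0 with h0 | h0
        · have : (fun i => α i * (Pi.single j (1 : ℂ) : Fin m → ℂ) i) = 0 := by
            ext i
            rcases eq_or_ne i j with rfl | hi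
            · simp [h0]
            · simp [hi]
          simp [this, ellNorm]
        · have : (fun i => β i * (Pi.single k (1 : ℂ) : Fin n → ℂ) i) = 0 := by
            ext i
            rcases eq_or_ne i k with rfl | hi
            · simp [h0]
            · simp [hi]
          simp [this, ellNorm]
      simp [hz]
    · push Not at h0
      have := h0.1
      have := h0.2
      field_simp
  · rw [matForm_diag]
    have hle : ∀ {l : ℕ} (γ z : Fin l → ℂ) (i : Fin l), ‖γ i * ((γ i)⁻¹ * z i)‖ ≤ ‖z i‖ := by
      intro l γ z i
      rcases eq_or_ne (γ i) 0 with h0 | h0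
      · simp [h0]
      · rw [mul_inv_cancel_left₀ h0]
    exact (hαβ _ _).trans (mul_le_mul_right (mul_le_mul' (ellNorm_mono _ (hle α x))
      (ellNorm_mono _ (hle β y))) _)

end Domination

/-! ### Tensor norms -/

section TensorNorms

variable {X Y : Type*} [NormedAddCommGroup X] [NormedSpace ℂ X]
  [NormedAddCommGroup Y] [NormedSpace ℂ Y]

@[simp]
theorem tensorPairing_tmul_tmul (x' : StrongDual ℂ X) (y' : StrongDual ℂ Y) (x : X) (y : Y) :
    tensorPairing (x' ⊗ₜ[ℂ] y') (x ⊗ₜ[ℂ] y) = x' x * y' y := by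
  simp [tensorPairing]

theorem tensorPairing_smul_left (c : ℂ) (v : StrongDual ℂ X ⊗[ℂ] StrongDual ℂ Y) (u : X ⊗[ℂ] Y) :
    tensorPairing (c • v) u = c * tensorPairing v u := by
  simp [tensorPairing]

theorem tensorPairing_sum_left {ι : Type*} (s : Finset ι)
    (v : ι → StrongDual ℂ X ⊗[ℂ] StrongDual ℂ Y) (u : X ⊗[ℂ] Y) :
    tensorPairing (∑ i ∈ s, v i) u = ∑ i ∈ s, tensorPairing (v i) u := by
  simp [tensorPairing]

theorem tensorPairing_add_right (v : StrongDual ℂ X ⊗[ℂ] StrongDual ℂ Y) (u w : X ⊗[ℂ] Y) :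
    tensorPairing v (u + w) = tensorPairing v u + tensorPairing v w := by
  simp [tensorPairing]

theorem tensorPairing_smul_right (c : ℂ) (v : StrongDual ℂ X ⊗[ℂ] StrongDual ℂ Y) (u : X ⊗[ℂ] Y) :
    tensorPairing v (c • u) = c * tensorPairing v u := by
  simp [tensorPairing]

theorem tensorPairing_sum_right {ι : Type*} (s : Finset ι)
    (v : StrongDual ℂ X ⊗[ℂ] StrongDual ℂ Y) (u : ι → X ⊗[ℂ] Y) :
    tensorPairing v (∑ i ∈ s, u i) = ∑ i ∈ s, tensorPairing v (u i) := by
  simp [tensorPairing]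

theorem tensorPairing_map {X' Y' : Type*} [NormedAddCommGroup X'] [NormedSpace ℂ X']
    [NormedAddCommGroup Y'] [NormedSpace ℂ Y'] (x' : StrongDual ℂ X') (y' : StrongDual ℂ Y')
    (P : X →L[ℂ] X') (Q : Y →L[ℂ] Y') (u : X ⊗[ℂ] Y) :
    tensorPairing (x' ⊗ₜ[ℂ] y') (TensorProduct.map (P : X →ₗ[ℂ] X') (Q : Y →ₗ[ℂ] Y') u) =
      tensorPairing ((x' ∘L P) ⊗ₜ[ℂ] (y' ∘L Q)) u := by
  induction u with
  | zero => simp [tensorPairing]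
  | tmul x y => simp
  | add u w hu hw => rw [map_add, tensorPairing_add_right, tensorPairing_add_right, hu, hw]

theorem tensorPairing_sum_sum {m n : ℕ} (a : Fin m → ℂ) (b : Fin n → ℂ)
    (x' : Fin m → StrongDual ℂ X) (y' : Fin n → StrongDual ℂ Y) (u : X ⊗[ℂ] Y) :
    tensorPairing ((∑ j, a j • x' j) ⊗ₜ[ℂ] (∑ k, b k • y' k)) u =
      matForm (fun j k => tensorPairing (x' j ⊗ₜ[ℂ] y' k) u) a b := by
  simp_rw [TensorProduct.sum_tmul, TensorProduct.tmul_sum, tensorPairing_sum_left, matForm,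
    TensorProduct.smul_tmul_smul, tensorPairing_smul_left]
  exact Finset.sum_congr rfl fun j _ => Finset.sum_congr rfl fun k _ => mul_comm _ _

theorem exists_norm_le_one_eq_norm_smul {V : Type*} [NormedAddCommGroup V] [NormedSpace ℂ V]
    (v : V) : ∃ w : V, ‖w‖ ≤ 1 ∧ v = (‖v‖ : ℂ) • w := by
  rcases eq_or_ne v 0 with rfl | hv
  · exact ⟨0, by simp, by simp⟩
  · refine ⟨((‖v‖ : ℂ))⁻¹ • v, ?_, ?_⟩
    · rw [norm_smul, norm_inv, Complex.norm_real, norm_norm,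
        inv_mul_cancel₀ (norm_ne_zero_iff.2 hv)]
    · rw [smul_inv_smul₀]
      exact_mod_cast norm_ne_zero_iff.2 hv

theorem enorm_tensorPairing_le_injNorm (x' : StrongDual ℂ X) (y' : StrongDual ℂ Y) (u : X ⊗[ℂ] Y) :
    ‖tensorPairing (x' ⊗ₜ[ℂ] y') u‖ₑ ≤ injNorm u * (‖x'‖ₑ * ‖y'‖ₑ) := by
  obtain ⟨x₁, hx₁, hx⟩ := exists_norm_le_one_eq_norm_smul x'
  obtain ⟨y₁, hy₁, hy⟩ := exists_norm_le_one_eq_norm_smul y'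
  have h1 : ‖tensorPairing (x₁ ⊗ₜ[ℂ] y₁) u‖ₑ ≤ injNorm u :=
    le_iSup₂_of_le x₁ hx₁ (le_iSup₂_of_le y₁ hy₁ le_rfl)
  have h2 : ‖tensorPairing (x' ⊗ₜ[ℂ] y') u‖ₑ =
      ‖x'‖ₑ * ‖y'‖ₑ * ‖tensorPairing (x₁ ⊗ₜ[ℂ] y₁) u‖ₑ := by
    conv_lhs => rw [hx, hy, TensorProduct.smul_tmul_smul, tensorPairing_smul_left, enorm_mul,
      enorm_mul]
    simp [← ofReal_norm]
  rw [h2, mul_comm]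
  gcongr

theorem lapresteNorm_smul_le (p q : ℝ≥0∞) {c : ℂ} (hc : c ≠ 0) (z : X ⊗[ℂ] Y) :
    lapresteNorm p q (c • z) ≤ ‖c‖ₑ * lapresteNorm p q z := by
  have h0 : ‖c‖ₑ ≠ 0 := enorm_ne_zero.2 hc
  have ht : ‖c‖ₑ ≠ ∞ := enorm_ne_top
  unfold lapresteNorm
  simp_rw [ENNReal.mul_iInf_of_ne h0 ht]
  refine le_iInf fun n => le_iInf fun d => le_iInf fun x => le_iInf fun y => le_iInf fun hz => ?_
  refine iInf_le_of_le n <| iInf_le_of_le (fun i => c * d i) <| iInf_le_of_le x <|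
    iInf_le_of_le y <| iInf_le_of_le ?_ ?_
  · rw [hz, Finset.smul_sum]
    simp_rw [mul_smul]
  · rw [ellNorm_const_mul]
    simp_rw [mul_assoc]
    exact le_rfl

/-- Homogeneity, with ε added because the infimum defining the norm of v is not known to be
positive. Finiteness of the dual norm lets ε tend to 0. -/
theorem enorm_tensorPairing_le_lapresteNorm (p q : ℝ≥0∞)
    (v : StrongDual ℂ X ⊗[ℂ] StrongDual ℂ Y) (u : X ⊗[ℂ] Y) (hu : lapresteDualNormFin p q u ≠ ∞)
    (hv : lapresteNorm p q v ≠ ∞) :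
    ‖tensorPairing v u‖ₑ ≤ lapresteDualNormFin p q u * lapresteNorm p q v := by
  have key : ∀ ε : ℝ≥0, 0 < ε → ‖tensorPairing v u‖ₑ ≤
      lapresteDualNormFin p q u * (lapresteNorm p q v + ε) := by
    intro ε hε
    set R := lapresteNorm p q v + ε with hR
    have hRt : R ≠ ∞ := by simp [hR, hv]
    have hR0 : R ≠ 0 := by simp [hR, hε.ne']
    have hRn : ‖(R.toReal : ℂ)‖ₑ = R := by
      rw [← ofReal_norm, Complex.norm_real, Real.norm_of_nonneg ENNReal.toReal_nonneg,
        ENNReal.ofReal_toReal hRt]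
    have hRc : (R.toReal : ℂ) ≠ 0 := by
      exact_mod_cast (ENNReal.toReal_pos hR0 hRt).ne'
    have h1 : lapresteNorm p q ((R.toReal : ℂ)⁻¹ • v) ≤ 1 := by
      refine (lapresteNorm_smul_le p q (inv_ne_zero hRc) v).trans ?_
      rw [enorm_inv hRc, hRn, mul_comm]
      exact ENNReal.mul_le_of_le_div (by simp [hR])
    have h2 : ‖tensorPairing ((R.toReal : ℂ)⁻¹ • v) u‖ₑ ≤ lapresteDualNormFin p q u :=
      le_iSup₂_of_le _ h1 le_rfl
    rw [tensorPairing_smul_left, enorm_mul, enorm_inv hRc, hRn, mul_comm] at h2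
    rw [← ENNReal.div_le_iff hR0 hRt]
    exact h2
  have hlim : Filter.Tendsto (fun ε : ℝ≥0 => lapresteDualNormFin p q u *
      (lapresteNorm p q v + ε)) (nhdsWithin 0 (Set.Ioi 0))
      (nhds (lapresteDualNormFin p q u * (lapresteNorm p q v + (0 : ℝ≥0)))) := by
    refine Filter.Tendsto.mono_left ?_ nhdsWithin_le_nhds
    refine ENNReal.Tendsto.const_mul ?_ (Or.inr hu)
    exact tendsto_const_nhds.add (ENNReal.tendsto_coe.2 Filter.tendsto_id)
  rw [ENNReal.coe_zero, add_zero] at hlim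
  exact ge_of_tendsto hlim (by filter_upwards [self_mem_nhdsWithin] with ε hε using key ε hε)

/-- A tensor of norm at most 1 has representations of cost below 1 + ε, so it is enough to test
explicit representations. -/
theorem lapresteDualNormFin_le {p q : ℝ≥0∞} {u : X ⊗[ℂ] Y} {A : ℝ≥0∞}
    (h : ∀ (N : ℕ) (c : Fin N → ℂ) (x : Fin N → StrongDual ℂ X) (y : Fin N → StrongDual ℂ Y),
      ‖∑ i, c i * tensorPairing (x i ⊗ₜ[ℂ] y i) u‖ₑ ≤ A * (ellNorm (p⁻¹ + q⁻¹ - 1)⁻¹ c *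
        weakNorm (ENNReal.conjExponent q) x * weakNorm (ENNReal.conjExponent p) y)) :
    lapresteDualNormFin p q u ≤ A := by
  refine iSup₂_le fun v hv => ?_
  rcases eq_or_ne A ∞ with rfl | hA
  · exact le_top
  have key : ∀ ε : ℝ≥0, 0 < ε → ‖tensorPairing v u‖ₑ ≤ A * (1 + ε) := by
    intro ε hε
    have hlt : lapresteNorm p q v < 1 + ε :=
      hv.trans_lt (ENNReal.lt_add_right ENNReal.one_ne_top (by simpa using hε.ne'))
    simp only [lapresteNorm, iInf_lt_iff] at hlt
    obtain ⟨N, c, x, y, rfl, hlt⟩ := hlt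
    rw [tensorPairing_sum_left]
    simp_rw [tensorPairing_smul_left]
    exact (h N c x y).trans (mul_le_mul_right hlt.le A)
  have hlim : Filter.Tendsto (fun ε : ℝ≥0 => A * (1 + (ε : ℝ≥0∞))) (nhdsWithin 0 (Set.Ioi 0))
      (nhds (A * (1 + (0 : ℝ≥0)))) := by
    refine Filter.Tendsto.mono_left ?_ nhdsWithin_le_nhds
    refine ENNReal.Tendsto.const_mul ?_ (Or.inr hA)
    exact tendsto_const_nhds.add (ENNReal.tendsto_coe.2 Filter.tendsto_id)
  rw [ENNReal.coe_zero, add_zero, mul_one] at hlim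
  exact ge_of_tendsto hlim (by filter_upwards [self_mem_nhdsWithin] with ε hε using key ε hε)

end TensorNorms

/-! ### Step functions on finitely many disjoint sets of finite measure -/

section Disjoint

variable {Ω : Type*} {m : ℕ} {A : Fin m → Set Ω}

theorem sum_indicator_of_mem {E : Type*} [AddCommMonoid E]
    (hA : Pairwise (Function.onFun Disjoint A)) (g : Fin m → Ω → E) {j : Fin m}
    {x : Ω} (hx : x ∈ A j) : ∑ i, (A i).indicator (g i) x = g j x := by
  rw [Finset.sum_eq_single j (fun i _ hi => ?_) (by simp), Set.indicator_of_mem hx]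
  exact Set.indicator_of_notMem (fun h => (Set.disjoint_left.1 (hA hi) h hx)) _

theorem sum_indicator_of_notMem {E : Type*} [AddCommMonoid E] (g : Fin m → Ω → E) {x : Ω}
    (hx : ∀ j, x ∉ A j) : ∑ i, (A i).indicator (g i) x = 0 :=
  Finset.sum_eq_zero fun i _ => Set.indicator_of_notMem (hx i) _

/-- The `L^p` norm of a disjoint sum is the `ℓ_p` norm of the `L^p` norms. -/
theorem eLpNorm_sum_indicator [MeasurableSpace Ω] {μ : Measure Ω} {p : ℝ≥0∞} (hp : p ≠ 0) (hAm : ∀ j, MeasurableSet (A j))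
    (hA : Pairwise (Function.onFun Disjoint A)) {g : Fin m → Ω → ℂ}
    (hg : ∀ j, AEStronglyMeasurable (g j) μ)
    (hfin : ∀ j, eLpNorm ((A j).indicator (g j)) p μ ≠ ∞) :
    eLpNorm (fun x => ∑ j, (A j).indicator (g j) x) p μ =
      ellNorm p (fun j => ((eLpNorm ((A j).indicator (g j)) p μ).toReal : ℂ)) := by
  have hen : ∀ j, ‖((eLpNorm ((A j).indicator (g j)) p μ).toReal : ℂ)‖ₑ =
      eLpNorm ((A j).indicator (g j)) p μ := fun j => by
    rw [← ofReal_norm, Complex.norm_real, Real.norm_of_nonneg ENNReal.toReal_nonneg,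
      ENNReal.ofReal_toReal (hfin j)]
  rcases eq_or_ne p ∞ with rfl | hpt
  · rw [ellNorm_top]
    simp_rw [hen]
    refine le_antisymm ?_ (iSup_le fun j => ?_)
    · rw [eLpNorm_exponent_top]
      refine essSup_le_of_ae_le _ ?_
      filter_upwards [ae_all_iff.2 fun j => enorm_ae_le_eLpNormEssSup ((A j).indicator (g j)) μ]
        with x hx
      by_cases h : ∃ j, x ∈ A j
      · obtain ⟨j, hj⟩ := h
        rw [sum_indicator_of_mem hA g hj]
        refine le_trans ?_ (le_iSup _ j)
        rw [eLpNorm_exponent_top]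
        refine le_trans ?_ (hx j)
        rw [Set.indicator_of_mem hj]
      · push Not at h
        rw [sum_indicator_of_notMem g h]
        simp
    · refine eLpNorm_mono fun x => ?_
      by_cases h : x ∈ A j
      · rw [sum_indicator_of_mem hA g h, Set.indicator_of_mem h]
      · rw [Set.indicator_of_notMem h, norm_zero]
        exact norm_nonneg _
  · have hp' := ENNReal.toReal_pos hp hpt
    have hpow : ∀ f : Ω → ℂ, eLpNorm f p μ ^ p.toReal = ∫⁻ x, ‖f x‖ₑ ^ p.toReal ∂μ := fun f => by
      rw [eLpNorm_eq_lintegral_rpow_enorm_toReal hp hpt, ← ENNReal.rpow_mul,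
        one_div_mul_cancel hp'.ne', ENNReal.rpow_one]
    apply (ENNReal.rpow_left_injective hp'.ne')
    dsimp only
    rw [ellNorm_rpow hp hpt, hpow]
    simp_rw [hen, hpow]
    rw [← lintegral_finsetSum' _ fun j _ =>
      (((hg j).indicator (hAm j)).enorm.pow_const p.toReal)]
    refine lintegral_congr fun x => ?_
    have hind : ∀ j, ‖(A j).indicator (g j) x‖ₑ ^ p.toReal =
        (A j).indicator (fun x => ‖g j x‖ₑ ^ p.toReal) x := fun j => by
      by_cases h : x ∈ A j
      · simp [h]
      · simp [h, hp']
    simp_rw [hind]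
    by_cases h : ∃ j, x ∈ A j
    · obtain ⟨j, hj⟩ := h
      rw [sum_indicator_of_mem hA _ hj, sum_indicator_of_mem hA _ hj]
    · push Not at h
      rw [sum_indicator_of_notMem _ h, sum_indicator_of_notMem _ h]
      simp [hp']

end Disjoint

/-! ### Normalised indicators, step functions and averaging projections of L¹ -/

theorem enorm_lpPairing_le {Ω : Type*} [MeasurableSpace Ω] {μ : Measure Ω} {p q : ℝ≥0∞}
    [ENNReal.HolderConjugate p q] [Fact (1 ≤ p)] [Fact (1 ≤ q)] (f : Lp ℂ p μ) (g : Lp ℂ q μ) :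
    ‖(ContinuousLinearMap.mul ℂ ℂ).lpPairing μ p q f g‖ₑ ≤ ‖f‖ₑ * ‖g‖ₑ := by
  have h : ‖(ContinuousLinearMap.mul ℂ ℂ).lpPairing μ p q f g‖ ≤ ‖f‖ * ‖g‖ := by
    rw [ContinuousLinearMap.lpPairing_eq_integral,
      ← integral_congr_ae (ContinuousLinearMap.coeFn_holder (r := 1) _ _ _)]
    refine (norm_integral_le_integral_norm _).trans ?_
    rw [← L1.norm_eq_integral_norm]
    refine ((ContinuousLinearMap.mul ℂ ℂ).norm_holder_apply_apply_le _ _).trans ?_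
    simp
  simpa [← ofReal_norm, ← ENNReal.ofReal_mul] using ENNReal.ofReal_le_ofReal h

/-- Finitely many disjoint measurable sets of positive finite measure. -/
structure StepFamily {Ω : Type*} [MeasurableSpace Ω] (μ : Measure Ω) (m : ℕ) where
  /-- the sets of the family -/
  set : Fin m → Set Ω
  measurableSet (j : Fin m) : MeasurableSet (set j)
  disjoint : Pairwise (Function.onFun Disjoint set)
  ne_zero (j : Fin m) : μ (set j) ≠ 0
  ne_top (j : Fin m) : μ (set j) ≠ ∞

namespace StepFamily

variable {Ω : Type*} [MeasurableSpace Ω] {μ : Measure Ω} {m : ℕ} (S : StepFamily μ m)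

theorem measureReal_pos (j : Fin m) : 0 < μ.real (S.set j) :=
  ENNReal.toReal_pos (S.ne_zero j) (S.ne_top j)

/-- The multiple of the indicator of the `j`-th set that is a unit vector of `L^s`. -/
noncomputable def vec (s : ℝ≥0∞) (j : Fin m) : Lp ℂ s μ :=
  indicatorConstLp s (S.measurableSet j) (S.ne_top j)
    (((μ.real (S.set j)) ^ (-s⁻¹.toReal) : ℝ) : ℂ)

theorem coeFn_vec (s : ℝ≥0∞) (j : Fin m) : S.vec s j =ᵐ[μ] (S.set j).indicator fun _ =>
    (((μ.real (S.set j)) ^ (-s⁻¹.toReal) : ℝ) : ℂ) :=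
  indicatorConstLp_coeFn

/-- The step function with coefficients `b` in the unit vectors of `L^s`. -/
noncomputable def step (s : ℝ≥0∞) (b : Fin m → ℂ) : Lp ℂ s μ := ∑ j, b j • S.vec s j

theorem coeFn_step (s : ℝ≥0∞) (b : Fin m → ℂ) : S.step s b =ᵐ[μ] fun x =>
    ∑ j, (S.set j).indicator
      (fun _ => b j * (((μ.real (S.set j)) ^ (-s⁻¹.toReal) : ℝ) : ℂ)) x := by
  have h1 := Lp.coeFn_finsetSum (p := s) (μ := μ) Finset.univ (fun j => b j • S.vec s j)
  filter_upwards [h1, ae_all_iff.2 fun j => Lp.coeFn_smul (b j) (S.vec s j),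
    ae_all_iff.2 fun j => S.coeFn_vec s j] with x hx h2 h3
  rw [step, hx, Finset.sum_apply]
  refine Finset.sum_congr rfl fun j _ => ?_
  rw [h2, Pi.smul_apply, h3, smul_eq_mul]
  by_cases h : x ∈ S.set j <;> simp [h]

/-- The factor μ(A_j)^{-1/s} makes each indicator a unit vector, including s = ∞ where the exponent
is 0; disjointness then gives an isometric copy of ℓ_s. -/
theorem enorm_step {s : ℝ≥0∞} (hs : s ≠ 0) (b : Fin m → ℂ) : ‖S.step s b‖ₑ = ellNorm s b := by
  have hn : ∀ j, eLpNorm ((S.set j).indicator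
      (fun _ => b j * (((μ.real (S.set j)) ^ (-s⁻¹.toReal) : ℝ) : ℂ))) s μ = ‖b j‖ₑ := fun j => by
    have hpos := S.measureReal_pos j
    rw [eLpNorm_indicator_const' (S.measurableSet j) (S.ne_zero j) hs, enorm_mul, mul_assoc]
    conv_rhs => rw [← mul_one ‖b j‖ₑ]
    congr 1
    rw [← ofReal_norm, Complex.norm_real, Real.norm_of_nonneg (by positivity),
      ← ENNReal.ofReal_toReal (S.ne_top j), ← Measure.real,
      ENNReal.ofReal_rpow_of_pos hpos, ← ENNReal.ofReal_mul (by positivity),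
      ← Real.rpow_add hpos, ENNReal.toReal_inv, one_div, neg_add_cancel, Real.rpow_zero,
      ENNReal.ofReal_one]
  rw [Lp.enorm_def, eLpNorm_congr_ae (S.coeFn_step s b), eLpNorm_sum_indicator hs S.measurableSet
    S.disjoint (fun j => aestronglyMeasurable_const) (fun j => by rw [hn]; simp)]
  simp_rw [hn]
  rw [ellNorm, ellNorm]
  refine eLpNorm_congr_norm_ae (.of_forall fun j => ?_)
  simp

/-- Products of step functions. -/
theorem holder_vec_vec {s t r : ℝ≥0∞} (ht : t ≠ 0) (hs : s ≠ 0) [ENNReal.HolderTriple s t r]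
    (i j : Fin m) :
    (ContinuousLinearMap.mul ℂ ℂ).holder r (S.vec s i) (S.vec t j) =
      if i = j then S.vec r j else 0 := by
  have hexp : r⁻¹.toReal = s⁻¹.toReal + t⁻¹.toReal := by
    rw [← ENNReal.HolderTriple.inv_add_inv_eq_inv s t r,
      ENNReal.toReal_add (by simpa using hs) (by simpa using ht)]
  refine Lp.ext ?_
  split_ifs with hij
  · subst hij
    filter_upwards [(ContinuousLinearMap.mul ℂ ℂ).coeFn_holder (r := r) (S.vec s i) (S.vec t i),
      S.coeFn_vec s i, S.coeFn_vec t i, S.coeFn_vec r i] with x h1 h2 h3 h4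
    rw [h1, h2, h3, h4]
    by_cases h : x ∈ S.set i
    · simp only [h, Set.indicator_of_mem, ContinuousLinearMap.mul_apply']
      rw [← Complex.ofReal_mul, ← Real.rpow_add (S.measureReal_pos i), hexp, neg_add]
    · simp [h]
  · filter_upwards [(ContinuousLinearMap.mul ℂ ℂ).coeFn_holder (r := r) (S.vec s i) (S.vec t j),
      S.coeFn_vec s i, S.coeFn_vec t j, Lp.coeFn_zero ℂ r μ] with x h1 h2 h3 h4
    rw [h1, h2, h3, h4]
    by_cases h : x ∈ S.set i
    · have : x ∉ S.set j := Set.disjoint_left.1 (S.disjoint hij) h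
      simp [this]
    · simp [h]

/-- The integral over the `j`-th set. -/
noncomputable def coord (j : Fin m) : StrongDual ℂ (Lp ℂ 1 μ) :=
  (ContinuousLinearMap.mul ℂ ℂ).lpPairing μ ∞ 1 (S.vec ∞ j)

theorem coord_vec (i j : Fin m) : S.coord i (S.vec 1 j) = if i = j then 1 else 0 := by
  have h1 : S.coord i (S.vec 1 j) =
      ∫ x, (ContinuousLinearMap.mul ℂ ℂ).holder 1 (S.vec ∞ i) (S.vec 1 j) x ∂μ := by
    rw [coord, ContinuousLinearMap.lpPairing_eq_integral]
    exact (integral_congr_ae (ContinuousLinearMap.coeFn_holder _ _ _)).symm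
  rw [h1, S.holder_vec_vec one_ne_zero ENNReal.top_ne_zero]
  split_ifs
  · rw [integral_congr_ae (S.coeFn_vec 1 j), integral_indicator_const _ (S.measurableSet j)]
    have hpos : ((μ.real (S.set j) : ℝ) : ℂ) ≠ 0 := by
      exact_mod_cast (S.measureReal_pos j).ne'
    simp [Real.rpow_neg_one, hpos]
  · rw [integral_congr_ae (Lp.coeFn_zero ℂ 1 μ)]
    simp

theorem coord_step (i : Fin m) (b : Fin m → ℂ) : S.coord i (S.step 1 b) = b i := by
  simp [step, coord_vec]

/-- The combination is integration against a step function of supremum norm ‖a‖_∞. Hence the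
coordinates map ℓ_∞ contractively into the dual of L¹, which is why matrices are tested on ℓ_∞. -/
theorem enorm_sum_mul_coord_le (a : Fin m → ℂ) (f : Lp ℂ 1 μ) :
    ‖∑ j, a j * S.coord j f‖ₑ ≤ ‖f‖ₑ * ellNorm ∞ a := by
  have h1 : ∑ j, a j * S.coord j f =
      (ContinuousLinearMap.mul ℂ ℂ).lpPairing μ ∞ 1 (S.step ∞ a) f := by
    simp [step, coord]
  rw [h1, ← S.enorm_step ENNReal.top_ne_zero, mul_comm]
  exact enorm_lpPairing_le _ _

theorem ellNorm_coord_le (f : Lp ℂ 1 μ) : ellNorm 1 (fun j => S.coord j f) ≤ ‖f‖ₑ := by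
  refine ellNorm_le_of_forall_sum_mul_le (t := ∞) _ fun a => ?_
  simp_rw [mul_comm _ (a _)]
  exact S.enorm_sum_mul_coord_le a f

/-- The averaging projection of `L¹` onto the step functions. -/
noncomputable def proj : Lp ℂ 1 μ →L[ℂ] Lp ℂ 1 μ :=
  ∑ j, (S.coord j).smulRight (S.vec 1 j)

theorem proj_apply (f : Lp ℂ 1 μ) : S.proj f = S.step 1 fun j => S.coord j f := by
  simp [proj, step]

theorem norm_proj_le (f : Lp ℂ 1 μ) : ‖S.proj f‖ ≤ ‖f‖ := by
  have h := S.ellNorm_coord_le f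
  rw [← S.enorm_step one_ne_zero, ← proj_apply] at h
  exact enorm_le_iff_norm_le.1 h

theorem proj_step (b : Fin m → ℂ) : S.proj (S.step 1 b) = S.step 1 b := by
  simp [proj_apply, coord_step]

end StepFamily

/-- One simple function approximates the vector-valued map (f_1, …, f_N), so its fibres serve all
f_i at once. The projection fixes step functions and is a contraction, so an approximation error ε/2
at most doubles. -/
theorem exists_stepFamily_norm_sub_lt {Ω : Type*} [MeasurableSpace Ω] {μ : Measure Ω} {N : ℕ}
    (f : Fin N → Lp ℂ 1 μ) {ε : ℝ} (hε : 0 < ε) :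
    ∃ (m : ℕ) (S : StepFamily μ m), ∀ i, ‖S.proj (f i) - f i‖ < ε := by
  classical
  have hF : MemLp (fun x i => f i x) 1 μ := memLp_pi_iff.2 fun i => Lp.memLp (f i)
  obtain ⟨g, hg, hgm⟩ := hF.exists_simpleFunc_eLpNorm_sub_lt ENNReal.one_ne_top
    (ε := ENNReal.ofReal (ε / 2)) (by simpa using hε)
  -- Discarding the value 0 and the values taken on null sets leaves fibres of positive finite
  -- measure.
  set V := {c ∈ g.range | c ≠ 0 ∧ μ (g ⁻¹' {c}) ≠ 0} with hV
  have hVc : ∀ c : V, c.1 ≠ 0 ∧ μ (g ⁻¹' {c.1}) ≠ 0 := fun c => (Finset.mem_filter.1 c.2).2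
  let e := V.equivFin
  let S : StepFamily μ V.card :=
    { set := fun l => g ⁻¹' {(e.symm l).1}
      measurableSet := fun l => g.measurableSet_fiber _
      disjoint := fun l l' hl => by
        refine Set.disjoint_left.2 fun x hx hx' => hl (e.symm.injective (Subtype.ext ?_))
        exact (Set.mem_singleton_iff.1 hx).symm.trans (Set.mem_singleton_iff.1 hx')
      ne_zero := fun l => (hVc _).2
      ne_top := fun l => (SimpleFunc.measure_preimage_lt_top_of_memLp one_ne_zero
        ENNReal.one_ne_top g hgm _ (hVc _).1).ne }
  -- The factor μ(A_l) compensates the normalisation μ(A_l)⁻¹ of the unit vectors of L¹.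
  let b : Fin N → Fin V.card → ℂ := fun i l => (e.symm l).1 i * μ.real (S.set l)
  have hb : ∀ i, S.step 1 (b i) =ᵐ[μ] fun x => g x i := by
    intro i
    have hnull : ∀ᵐ x ∂μ, ∀ c ∈ g.range, μ (g ⁻¹' {c}) = 0 → g x ≠ c := by
      rw [Finset.eventually_all]
      intro c _
      by_cases hc : μ (g ⁻¹' {c}) = 0
      · filter_upwards [measure_eq_zero_iff_ae_notMem.1 hc] with x hx _ h
        exact hx h
      · exact .of_forall fun x h => absurd h hc
    filter_upwards [S.coeFn_step 1 (b i), hnull] with x h1 h2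
    rw [h1]
    by_cases h : ∃ l, x ∈ S.set l
    · obtain ⟨l, hl⟩ := h
      rw [sum_indicator_of_mem S.disjoint _ hl]
      have hpos := S.measureReal_pos l
      have hgx : g x = (e.symm l).1 := hl
      have : ((μ.real (S.set l) : ℝ) : ℂ) ≠ 0 := by exact_mod_cast hpos.ne'
      simp [b, hgx, Real.rpow_neg_one, this]
    · push Not at h
      rw [sum_indicator_of_notMem _ h]
      by_cases h0 : g x = 0
      · simp [h0]
      · have hm : g x ∈ V := by
          refine Finset.mem_filter.2 ⟨g.mem_range_self x, h0, fun hz => ?_⟩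
          exact h2 _ (g.mem_range_self x) hz rfl
        refine absurd ?_ (h (e ⟨g x, hm⟩))
        simp [S]
  have hclose : ∀ i, ‖f i - S.step 1 (b i)‖ < ε / 2 := by
    intro i
    have h1 : ‖f i - S.step 1 (b i)‖ₑ < ENNReal.ofReal (ε / 2) := by
      rw [Lp.enorm_def]
      refine lt_of_le_of_lt ?_ hg
      refine eLpNorm_mono_ae ?_
      filter_upwards [Lp.coeFn_sub (f i) (S.step 1 (b i)), hb i] with x h1 h2
      rw [h1, Pi.sub_apply, h2]
      exact norm_le_pi_norm (((fun x i => f i x) - ⇑g : Ω → Fin N → ℂ) x) i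
    rw [← ofReal_norm] at h1
    exact (ENNReal.ofReal_lt_ofReal_iff (by positivity)).1 h1
  refine ⟨_, S, fun i => ?_⟩
  calc ‖S.proj (f i) - f i‖ = ‖S.proj (f i - S.step 1 (b i)) - (f i - S.step 1 (b i))‖ := by
        rw [map_sub, S.proj_step]
        congr 1
        abel
    _ ≤ ‖f i - S.step 1 (b i)‖ + ‖f i - S.step 1 (b i)‖ :=
        (norm_sub_le _ _).trans (add_le_add_left (S.norm_proj_le _) _)
    _ < ε := by linarith [hclose i]

theorem exists_stepFamily_tendsto {Ω : Type*} [MeasurableSpace Ω] {μ : Measure Ω} {N : ℕ}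
    (f : Fin N → Lp ℂ 1 μ) :
    ∃ (m : ℕ → ℕ) (S : ∀ l, StepFamily μ (m l)), ∀ i,
      Filter.Tendsto (fun l => (S l).proj (f i)) Filter.atTop (nhds (f i)) := by
  choose m S hS using fun l : ℕ =>
    exists_stepFamily_norm_sub_lt f (Nat.one_div_pos_of_nat (α := ℝ) (n := l))
  refine ⟨m, S, fun i => tendsto_iff_norm_sub_tendsto_zero.2 ?_⟩
  exact squeeze_zero (fun l => norm_nonneg _) (fun l => (hS l i).le)
    tendsto_one_div_add_atTop_nhds_zero_nat

/-! ### Linearity of the operator pairing and passage from averages to tensors -/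

section Pairing

variable {X Y : Type*} [NormedAddCommGroup X] [NormedSpace ℂ X]
  [NormedAddCommGroup Y] [NormedSpace ℂ Y]

@[simp]
theorem opPairing_tmul (T : X →L[ℂ] StrongDual ℂ Y) (x : X) (y : Y) :
    opPairing T (x ⊗ₜ[ℂ] y) = T x y := by
  simp [opPairing]

theorem opPairing_add (T : X →L[ℂ] StrongDual ℂ Y) (ξ η : X ⊗[ℂ] Y) :
    opPairing T (ξ + η) = opPairing T ξ + opPairing T η := by
  simp [opPairing]

theorem opPairing_smul (T : X →L[ℂ] StrongDual ℂ Y) (c : ℂ) (ξ : X ⊗[ℂ] Y) :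
    opPairing T (c • ξ) = c * opPairing T ξ := by
  simp [opPairing]

theorem opPairing_sum {ι : Type*} (s : Finset ι) (T : X →L[ℂ] StrongDual ℂ Y) (ξ : ι → X ⊗[ℂ] Y) :
    opPairing T (∑ i ∈ s, ξ i) = ∑ i ∈ s, opPairing T (ξ i) := by
  simp [opPairing]

end Pairing

/-- A bound on the averages of `ξ ∈ L¹ ⊗ L¹` passes to `ξ`. -/
theorem enorm_opPairing_le_of_proj {Ω₁ Ω₂ : Type*} [MeasurableSpace Ω₁] [MeasurableSpace Ω₂]
    {μ₁ : Measure Ω₁} {μ₂ : Measure Ω₂} (T : Lp ℂ 1 μ₁ →L[ℂ] StrongDual ℂ (Lp ℂ 1 μ₂))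
    (ξ : Lp ℂ 1 μ₁ ⊗[ℂ] Lp ℂ 1 μ₂) {D : ℝ≥0∞}
    (h : ∀ (m n : ℕ) (S : StepFamily μ₁ m) (R : StepFamily μ₂ n),
      ‖opPairing T (TensorProduct.map (S.proj : Lp ℂ 1 μ₁ →ₗ[ℂ] Lp ℂ 1 μ₁)
        (R.proj : Lp ℂ 1 μ₂ →ₗ[ℂ] Lp ℂ 1 μ₂) ξ)‖ₑ ≤ D) :
    ‖opPairing T ξ‖ₑ ≤ D := by
  obtain ⟨k, x, y, rfl⟩ := TensorProduct.exists_sum_tmul_eq ξ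
  obtain ⟨m, S, hS⟩ := exists_stepFamily_tendsto x
  obtain ⟨n, R, hR⟩ := exists_stepFamily_tendsto y
  have hlim : Filter.Tendsto (fun l => ‖∑ j, T ((S l).proj (x j)) ((R l).proj (y j))‖ₑ)
      Filter.atTop (nhds ‖∑ j, T (x j) (y j)‖ₑ) := by
    refine (continuous_enorm.tendsto _).comp (tendsto_finsetSum _ fun j _ => ?_)
    have h1 : Filter.Tendsto (fun l => T ((S l).proj (x j))) Filter.atTop (nhds (T (x j))) :=
      (T.continuous.tendsto _).comp (hS j)
    exact (isBoundedBilinearMap_apply.continuous.tendsto (T (x j), y j)).comp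
      (h1.prodMk_nhds (hR j))
  simp only [opPairing_sum, opPairing_tmul]
  refine le_of_tendsto hlim (.of_forall fun l => ?_)
  have := h _ _ (S l) (R l)
  simpa only [map_sum, TensorProduct.map_tmul, opPairing_sum, opPairing_tmul,
    ContinuousLinearMap.coe_coe] using this

/-! ### Weak norms of finite families of functionals -/

section WeakNorm

variable {X Y : Type*} [NormedAddCommGroup X] [NormedSpace ℂ X]
  [NormedAddCommGroup Y] [NormedSpace ℂ Y] {N m n : ℕ}

theorem ellNorm_apply_le_weakNorm (p : ℝ≥0∞) (x : Fin N → StrongDual ℂ X) {e : X}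
    (he : ‖e‖ ≤ 1) : ellNorm p (fun i => x i e) ≤ weakNorm p x :=
  le_iSup₂_of_le (NormedSpace.inclusionInDoubleDual ℂ X e)
    ((NormedSpace.double_dual_bound ℂ X e).trans he) le_rfl

/-- A functional x' of norm at most 1 restricts along φ to a functional on ℓ_∞ of norm at most 1,
that is, to coefficients in the unit ball of ℓ_1. The triangle inequality in ℓ_p finishes. -/
theorem weakNorm_sum_smul_le {p : ℝ≥0∞} (hp : 1 ≤ p) {φ : Fin m → StrongDual ℂ X}
    (hφ : ∀ b : Fin m → ℂ, ‖∑ j, b j • φ j‖ₑ ≤ ellNorm ∞ b) (a : Fin N → Fin m → ℂ) :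
    weakNorm p (fun i => ∑ j, a i j • φ j) ≤ ⨆ j, ellNorm p fun i => a i j := by
  refine iSup₂_le fun x' hx' => ?_
  have hc : ellNorm 1 (fun j => x' (φ j)) ≤ 1 := by
    refine ellNorm_le_of_forall_sum_mul_le (t := ∞) _ fun b => ?_
    have : ∑ j, x' (φ j) * b j = x' (∑ j, b j • φ j) := by
      simp [mul_comm]
    rw [this]
    refine (ContinuousLinearMap.le_opENorm x' _).trans (mul_le_mul' ?_ (hφ b))
    rw [← ofReal_norm]
    exact ENNReal.ofReal_le_one.2 hx'
  have hsum : (fun i => x' (∑ j, a i j • φ j)) = ∑ j, fun i => x' (φ j) * a i j := by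
    ext i
    simp [mul_comm]
  rw [hsum, ellNorm]
  refine (eLpNorm_sum_le (fun j _ => (memLp_count p _).1) hp).trans ?_
  calc ∑ j, ellNorm p (fun i => x' (φ j) * a i j)
      ≤ ∑ j, ‖x' (φ j)‖ₑ * ⨆ j, ellNorm p fun i => a i j := by
        refine Finset.sum_le_sum fun j _ => ?_
        rw [ellNorm_const_mul]
        gcongr
        exact le_iSup (fun j => ellNorm p fun i => a i j) j
    _ = ellNorm 1 (fun j => x' (φ j)) * ⨆ j, ellNorm p fun i => a i j := by
        rw [ellNorm_one, Finset.sum_mul]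
    _ ≤ ⨆ j, ellNorm p fun i => a i j := mul_le_of_le_one_left' hc

theorem iSup_ellNorm_ne_top (p : ℝ≥0∞) (a : Fin N → Fin m → ℂ) :
    ⨆ j, ellNorm p (fun i => a i j) ≠ ∞ := by
  refine ne_top_of_le_ne_top (b := ∑ j, ellNorm p fun i => a i j) ?_ (iSup_le fun j => ?_)
  · exact (ENNReal.sum_lt_top.2 fun j _ => ellNorm_lt_top _ _).ne
  · exact Finset.single_le_sum (f := fun j => ellNorm p fun i => a i j)
      (fun _ _ => zero_le) (Finset.mem_univ j)

variable {p p' q q' : ℝ≥0∞} [ENNReal.HolderConjugate p p'] [ENNReal.HolderConjugate q q']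

theorem conjExponent_left : ENNReal.conjExponent p' = p :=
  have : ENNReal.HolderConjugate p' p := .symm
  have : Fact (1 ≤ p') := ⟨ENNReal.HolderConjugate.one_le p' p⟩
  ENNReal.HolderConjugate.conjExponent_eq

theorem conjExponent_right : ENNReal.conjExponent q = q' :=
  have : Fact (1 ≤ q) := ⟨ENNReal.HolderConjugate.one_le q q'⟩
  ENNReal.HolderConjugate.conjExponent_eq

/-- The four reciprocals 1/p, 1/p', 1/q, 1/q' add up to 2. The assumption q ≤ p gives 1/q + 1/p' ≥
1, so the truncated subtraction is a true one. -/
theorem holderConjugate_lapresteExponent (hqp : q ≤ p) :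
    ENNReal.HolderConjugate (p⁻¹ + q'⁻¹)⁻¹ (q⁻¹ + p'⁻¹ - 1)⁻¹ := by
  have h1 := ENNReal.HolderConjugate.inv_add_inv_eq_one p p'
  have h2 := ENNReal.HolderConjugate.inv_add_inv_eq_one q q'
  have h3 : 1 ≤ q⁻¹ + p'⁻¹ := by
    rw [← h1]
    gcongr
  rw [ENNReal.holderConjugate_iff, inv_inv, inv_inv]
  have h4 : p⁻¹ + q'⁻¹ + (q⁻¹ + p'⁻¹ - 1) + 1 = 1 + 1 := by
    rw [add_assoc, tsub_add_cancel_of_le h3]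
    calc p⁻¹ + q'⁻¹ + (q⁻¹ + p'⁻¹) = (p⁻¹ + p'⁻¹) + (q⁻¹ + q'⁻¹) := by ring
      _ = 1 + 1 := by rw [h1, h2]
  exact (ENNReal.add_left_inj ENNReal.one_ne_top).1 h4

/-- Testing a tensor against functionals that span a quotient of `ℓ_∞`. -/
theorem lapresteBound_of_lapresteDualNormFin {φ : Fin m → StrongDual ℂ X}
    {ψ : Fin n → StrongDual ℂ Y} (hφ : ∀ b : Fin m → ℂ, ‖∑ j, b j • φ j‖ₑ ≤ ellNorm ∞ b)
    (hψ : ∀ b : Fin n → ℂ, ‖∑ k, b k • ψ k‖ₑ ≤ ellNorm ∞ b) {w : X ⊗[ℂ] Y}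
    (hw : lapresteDualNormFin q p' w ≠ ∞) :
    LapresteBound p q' (q⁻¹ + p'⁻¹ - 1)⁻¹ (fun j k => tensorPairing (φ j ⊗ₜ[ℂ] ψ k) w)
      (lapresteDualNormFin q p' w) := by
  intro N c x y
  set v : StrongDual ℂ X ⊗[ℂ] StrongDual ℂ Y :=
    ∑ i, c i • ((∑ j, x i j • φ j) ⊗ₜ[ℂ] (∑ k, y i k • ψ k)) with hv
  have h1 : ∑ i, c i * matForm (fun j k => tensorPairing (φ j ⊗ₜ[ℂ] ψ k) w) (x i) (y i) =
      tensorPairing v w := by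
    rw [hv, tensorPairing_sum_left]
    simp_rw [tensorPairing_smul_left, tensorPairing_sum_sum]
  have hp1 : 1 ≤ p := ENNReal.HolderConjugate.one_le p p'
  have hq1 : 1 ≤ q' := ENNReal.HolderConjugate.one_le q' q
  have h2 : lapresteNorm q p' v ≤ ellNorm (q⁻¹ + p'⁻¹ - 1)⁻¹ c *
      (⨆ j, ellNorm p fun i => x i j) * ⨆ k, ellNorm q' fun i => y i k := by
    refine iInf_le_of_le N <| iInf_le_of_le c <| iInf_le_of_le _ <| iInf_le_of_le _ <|
      iInf_le_of_le hv ?_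
    rw [conjExponent_left (p := p), conjExponent_right (q' := q')]
    gcongr
    · exact weakNorm_sum_smul_le hp1 hφ x
    · exact weakNorm_sum_smul_le hq1 hψ y
  rw [h1]
  refine (enorm_tensorPairing_le_lapresteNorm q p' v w hw (ne_top_of_le_ne_top ?_ h2)).trans
    (mul_le_mul_right h2 _)
  exact ENNReal.mul_ne_top (ENNReal.mul_ne_top (ellNorm_lt_top _ _).ne (iSup_ellNorm_ne_top _ _))
    (iSup_ellNorm_ne_top _ _)

end WeakNorm

/-! ### Averages of tensors -/

section Averages

variable {Ω₁ Ω₂ : Type*} [MeasurableSpace Ω₁] [MeasurableSpace Ω₂]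
  {μ₁ : Measure Ω₁} {μ₂ : Measure Ω₂} {m n : ℕ} (S : StepFamily μ₁ m) (R : StepFamily μ₂ n)

theorem map_proj_eq_sum (ξ : Lp ℂ 1 μ₁ ⊗[ℂ] Lp ℂ 1 μ₂) :
    TensorProduct.map (S.proj : Lp ℂ 1 μ₁ →ₗ[ℂ] Lp ℂ 1 μ₁)
      (R.proj : Lp ℂ 1 μ₂ →ₗ[ℂ] Lp ℂ 1 μ₂) ξ =
      ∑ j, ∑ k, tensorPairing (S.coord j ⊗ₜ[ℂ] R.coord k) ξ • (S.vec 1 j ⊗ₜ[ℂ] R.vec 1 k) := by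
  induction ξ with
  | zero => simp [tensorPairing]
  | tmul f g =>
    rw [TensorProduct.map_tmul, ContinuousLinearMap.coe_coe, ContinuousLinearMap.coe_coe,
      S.proj_apply, R.proj_apply, StepFamily.step, StepFamily.step, TensorProduct.sum_tmul]
    simp_rw [TensorProduct.tmul_sum, TensorProduct.smul_tmul_smul, tensorPairing_tmul_tmul]
  | add ξ η h1 h2 =>
    rw [map_add, h1, h2]
    simp_rw [tensorPairing_add_right, add_smul, Finset.sum_add_distrib]

theorem StepFamily.norm_vec_le {Ω : Type*} [MeasurableSpace Ω] {μ : Measure Ω}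
    (S : StepFamily μ m) (j : Fin m) : ‖S.vec 1 j‖ ≤ 1 := by
  have hpos := S.measureReal_pos j
  rw [StepFamily.vec, norm_indicatorConstLp one_ne_zero ENNReal.one_ne_top, Complex.norm_real,
    Real.norm_of_nonneg (by positivity)]
  simp [Real.rpow_neg_one, hpos.ne']

variable {p p' q q' : ℝ≥0∞} [ENNReal.HolderConjugate p p'] [ENNReal.HolderConjugate q q']

/-- The dual norm is an infimum over subspaces, so the spans of the normalised indicators may be
chosen. Functionals there enter only through their values on these vectors, which have norm at most
1, and such values are controlled by weak norms. -/
theorem lapresteDualNorm_map_proj_le {ξ : Lp ℂ 1 μ₁ ⊗[ℂ] Lp ℂ 1 μ₂} {A : ℝ≥0∞}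
    (h : LapresteBound p q' (q⁻¹ + p'⁻¹ - 1)⁻¹
      (fun j k => tensorPairing (S.coord j ⊗ₜ[ℂ] R.coord k) ξ) A) :
    lapresteDualNorm q p' (TensorProduct.map (S.proj : Lp ℂ 1 μ₁ →ₗ[ℂ] Lp ℂ 1 μ₁)
      (R.proj : Lp ℂ 1 μ₂ →ₗ[ℂ] Lp ℂ 1 μ₂) ξ) ≤ A := by
  set M := Submodule.span ℂ (Set.range (S.vec 1))
  set N := Submodule.span ℂ (Set.range (R.vec 1))
  let e : Fin m → M := fun j => ⟨S.vec 1 j, Submodule.subset_span ⟨j, rfl⟩⟩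
  let e' : Fin n → N := fun k => ⟨R.vec 1 k, Submodule.subset_span ⟨k, rfl⟩⟩
  have hM : FiniteDimensional ℂ M := FiniteDimensional.span_of_finite ℂ (Set.finite_range _)
  have hN : FiniteDimensional ℂ N := FiniteDimensional.span_of_finite ℂ (Set.finite_range _)
  refine iInf_le_of_le M <| iInf_le_of_le N <| iInf_le_of_le hM <| iInf_le_of_le hN <|
    iInf_le_of_le (∑ j, ∑ k, tensorPairing (S.coord j ⊗ₜ[ℂ] R.coord k) ξ • (e j ⊗ₜ[ℂ] e' k)) <|
    iInf_le_of_le ?_ ?_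
  · rw [map_proj_eq_sum]
    simp [TensorProduct.mapIncl, e, e']
  · refine lapresteDualNormFin_le fun L c x y => ?_
    have h1 : ∀ i, tensorPairing (x i ⊗ₜ[ℂ] y i)
        (∑ j, ∑ k, tensorPairing (S.coord j ⊗ₜ[ℂ] R.coord k) ξ • (e j ⊗ₜ[ℂ] e' k)) =
        matForm (fun j k => tensorPairing (S.coord j ⊗ₜ[ℂ] R.coord k) ξ)
          (fun j => x i (e j)) (fun k => y i (e' k)) := fun i => by
      simp_rw [tensorPairing_sum_right, tensorPairing_smul_right, tensorPairing_tmul_tmul, matForm]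
    simp_rw [h1]
    refine (h L c _ _).trans ?_
    rw [conjExponent_left (p := p), conjExponent_right (q' := q')]
    gcongr
    · exact iSup_le fun j => ellNorm_apply_le_weakNorm p x (S.norm_vec_le j)
    · exact iSup_le fun k => ellNorm_apply_le_weakNorm q' y (R.norm_vec_le k)

end Averages

/-! ### Schur bounds against factorable bounds -/

section Schur

variable {Ω₁ Ω₂ : Type*} [MeasurableSpace Ω₁] [MeasurableSpace Ω₂]
  {μ₁ : Measure Ω₁} {μ₂ : Measure Ω₂}

/-- Multiplication by `h ∈ L^q`, as an operator from `L^p` to `L¹`. -/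
noncomputable def mulRight {Ω : Type*} [MeasurableSpace Ω] {μ : Measure Ω} (p q : ℝ≥0∞)
    [ENNReal.HolderConjugate p q] [Fact (1 ≤ p)] [Fact (1 ≤ q)] (h : Lp ℂ q μ) :
    Lp ℂ p μ →L[ℂ] Lp ℂ 1 μ :=
  ((ContinuousLinearMap.mul ℂ ℂ).holderL μ p q 1).flip h

theorem mulRight_apply {Ω : Type*} [MeasurableSpace Ω] {μ : Measure Ω} (p q : ℝ≥0∞)
    [ENNReal.HolderConjugate p q] [Fact (1 ≤ p)] [Fact (1 ≤ q)] (h : Lp ℂ q μ) (f : Lp ℂ p μ) :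
    mulRight p q h f = (ContinuousLinearMap.mul ℂ ℂ).holder 1 f h := rfl

/-- Multiplication by a step function is diagonal on the normalised indicators; it realises the
diagonal factors of a matrix by functions in L^p and L^{q'}. -/
theorem mulRight_vec_step {Ω : Type*} [MeasurableSpace Ω] {μ : Measure Ω} {m : ℕ}
    (S : StepFamily μ m) (p q : ℝ≥0∞) [ENNReal.HolderConjugate p q] [Fact (1 ≤ p)] [Fact (1 ≤ q)] (a : Fin m → ℂ) (j : Fin m) :
    mulRight p q (S.step q a) (S.vec p j) = a j • S.vec 1 j := by
  have hp : p ≠ 0 := ENNReal.HolderConjugate.ne_zero p q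
  have hq : q ≠ 0 := ENNReal.HolderConjugate.ne_zero q p
  rw [mulRight, StepFamily.step, map_sum, sum_apply]
  simp_rw [map_smul, smul_apply]
  have : ∀ i, ((ContinuousLinearMap.mul ℂ ℂ).holderL μ p q 1).flip (S.vec q i) (S.vec p j) =
      if j = i then S.vec 1 i else 0 := fun i => by
    change (ContinuousLinearMap.mul ℂ ℂ).holder 1 (S.vec p j) (S.vec q i) = _
    rw [S.holder_vec_vec hq hp]
  simp [this]

namespace StepFamily

variable {Ω : Type*} [MeasurableSpace Ω] {μ : Measure Ω} {m : ℕ} (S : StepFamily μ m)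

theorem coord_apply (j : Fin m) (f : Lp ℂ 1 μ) : S.coord j f = ∫ x in S.set j, f x ∂μ := by
  rw [coord, ContinuousLinearMap.lpPairing_eq_integral, ← integral_indicator (S.measurableSet j)]
  refine integral_congr_ae ?_
  filter_upwards [S.coeFn_vec ∞ j] with x hx
  rw [hx]
  by_cases h : x ∈ S.set j <;> simp [h]

theorem enorm_sum_smul_coord_comp_subtypeL_le (M : Submodule ℂ (Lp ℂ 1 μ)) (b : Fin m → ℂ) :
    ‖∑ j, b j • (S.coord j ∘L M.subtypeL)‖ₑ ≤ ellNorm ∞ b := by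
  refine ContinuousLinearMap.opENorm_le_bound _ fun f => ?_
  rw [mul_comm]
  have h : (∑ j, b j • (S.coord j ∘L M.subtypeL)) f = ∑ j, b j * S.coord j (f : Lp ℂ 1 μ) := by
    simp
  rw [h]
  exact S.enorm_sum_mul_coord_le b (f : Lp ℂ 1 μ)

/-- The functionals `f ↦ ∫_{A_j} f h` on `L^{p'}`, `h ∈ L^p`, are multiples with `ℓ_p`-summable
coefficients of functionals spanning a copy of a quotient of `ℓ_p`. -/
theorem exists_coord_comp_mulRight (p' p : ℝ≥0∞) [ENNReal.HolderConjugate p' p]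
    [Fact (1 ≤ p')] [Fact (1 ≤ p)] (h : Lp ℂ p μ) :
    ∃ (η : Fin m → ℂ) (V : Fin m → StrongDual ℂ (Lp ℂ p' μ)), ellNorm p η ≤ ‖h‖ₑ ∧
      (∀ j, S.coord j ∘L mulRight p' p h = η j • V j) ∧
      ∀ a : Fin m → ℂ, ‖∑ j, a j • V j‖ₑ ≤ ellNorm p a := by
  have hp : p ≠ 0 := ENNReal.HolderConjugate.ne_zero p p'
  have hhm : AEStronglyMeasurable h μ := Lp.aestronglyMeasurable h
  have hind : ∀ j, eLpNorm ((S.set j).indicator h) p μ ≠ ∞ := fun j =>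
    ((Lp.memLp h).indicator (S.measurableSet j)).2.ne
  -- η_j is the L^p norm of h on A_j and V_j the normalised functional. Where η_j = 0 the function h
  -- vanishes a.e. on A_j, so the functional is 0 too.
  set η : Fin m → ℂ := fun j => ((eLpNorm ((S.set j).indicator h) p μ).toReal : ℂ) with hη
  have hcoord : ∀ j f, S.coord j (mulRight p' p h f) =
      ∫ x, f x * (S.set j).indicator h x ∂μ := by
    intro j f
    rw [coord_apply, ← integral_indicator (S.measurableSet j), mulRight_apply]
    refine integral_congr_ae ?_
    filter_upwards [(ContinuousLinearMap.mul ℂ ℂ).coeFn_holder (r := 1) f h] with x hx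
    by_cases hxj : x ∈ S.set j
    · simp [hxj, hx]
    · simp [hxj]
  refine ⟨η, fun j => (η j)⁻¹ • (S.coord j ∘L mulRight p' p h), ?_, fun j => ?_, fun a => ?_⟩
  · rw [hη, ← eLpNorm_sum_indicator hp S.measurableSet S.disjoint (fun _ => hhm) hind, Lp.enorm_def]
    refine eLpNorm_mono fun x => ?_
    by_cases hx : ∃ j, x ∈ S.set j
    · obtain ⟨j, hj⟩ := hx
      rw [sum_indicator_of_mem S.disjoint _ hj]
    · push Not at hx
      rw [sum_indicator_of_notMem _ hx, norm_zero]
      exact norm_nonneg _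
  · ext f
    change S.coord j (mulRight p' p h f) = η j * ((η j)⁻¹ * S.coord j (mulRight p' p h f))
    rcases eq_or_ne (η j) 0 with h0 | h0
    · have h1 : eLpNorm ((S.set j).indicator h) p μ = 0 := by
        have : (eLpNorm ((S.set j).indicator h) p μ).toReal = 0 := Complex.ofReal_eq_zero.1 h0
        exact ((ENNReal.toReal_eq_zero_iff _).1 this).resolve_right (hind j)
      rw [eLpNorm_eq_zero_iff (hhm.indicator (S.measurableSet j)) hp] at h1
      rw [h0, zero_mul, hcoord]
      refine integral_eq_zero_of_ae ?_
      filter_upwards [h1] with x hx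
      rw [hx]
      simp
    · rw [mul_inv_cancel_left₀ h0]
  · set g : Fin m → Ω → ℂ := fun j x => a j * (η j)⁻¹ * h x with hg
    have hgm : ∀ j, AEStronglyMeasurable (g j) μ := fun j => hhm.const_mul _
    have hgn : ∀ j, eLpNorm ((S.set j).indicator (g j)) p μ = ‖a j * (η j)⁻¹‖ₑ *
        eLpNorm ((S.set j).indicator h) p μ := fun j => by
      have : (S.set j).indicator (g j) = (a j * (η j)⁻¹) • (S.set j).indicator h := by
        ext x
        by_cases hx : x ∈ S.set j <;> simp [hx, hg]
      rw [this, eLpNorm_const_smul]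
    have hgf : ∀ j, eLpNorm ((S.set j).indicator (g j)) p μ ≠ ∞ := fun j => by
      rw [hgn]
      exact ENNReal.mul_ne_top enorm_ne_top (hind j)
    have hG := eLpNorm_sum_indicator hp S.measurableSet S.disjoint hgm hgf
    have hGm : MemLp (fun x => ∑ j, (S.set j).indicator (g j) x) p μ := by
      refine ⟨?_, ?_⟩
      · exact Finset.aestronglyMeasurable_fun_sum _ fun j _ =>
          (hgm j).indicator (S.measurableSet j)
      · rw [hG]
        exact ellNorm_lt_top _ _
    have hnorm : ‖hGm.toLp _‖ₑ ≤ ellNorm p a := by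
      rw [Lp.enorm_toLp, hG]
      refine ellNorm_mono p fun j => ?_
      rw [hgn, ENNReal.toReal_mul, Complex.norm_real, Real.norm_of_nonneg (by positivity),
        toReal_enorm, norm_mul, norm_inv, mul_assoc]
      refine mul_le_of_le_one_right (norm_nonneg _) ?_
      rw [hη, Complex.norm_real, Real.norm_of_nonneg ENNReal.toReal_nonneg]
      exact inv_mul_le_one
    refine ContinuousLinearMap.opENorm_le_bound _ fun f => ?_
    have hint : (∑ j, a j • (η j)⁻¹ • (S.coord j ∘L mulRight p' p h)) f =
        (ContinuousLinearMap.mul ℂ ℂ).lpPairing μ p' p f (hGm.toLp _) := by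
      rw [ContinuousLinearMap.lpPairing_eq_integral]
      have hfi : ∀ j, Integrable (fun x => f x * (S.set j).indicator h x) μ := fun j =>
        memLp_one_iff_integrable.1 (((Lp.memLp h).indicator (S.measurableSet j)).mul (Lp.memLp f))
      calc (∑ j, a j • (η j)⁻¹ • (S.coord j ∘L mulRight p' p h)) f
          = ∑ j, ∫ x, a j * (η j)⁻¹ * (f x * (S.set j).indicator h x) ∂μ := by
            simp [hcoord, integral_const_mul, mul_assoc]
        _ = ∫ x, ∑ j, a j * (η j)⁻¹ * (f x * (S.set j).indicator h x) ∂μ :=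
            (integral_finsetSum _ fun j _ => (hfi j).const_mul _).symm
        _ = _ := by
            refine integral_congr_ae ?_
            filter_upwards [hGm.coeFn_toLp] with x hx
            rw [hx, ContinuousLinearMap.mul_apply', Finset.mul_sum]
            refine Finset.sum_congr rfl fun j _ => ?_
            by_cases hxj : x ∈ S.set j
            · simp [hxj, hg]
              ring
            · simp [hxj]
    rw [hint, mul_comm]
    exact (enorm_lpPairing_le _ _).trans (mul_le_mul_right hnorm _)

end StepFamily

theorem StepFamily.ellNorm_dual_vec_le {Ω : Type*} [MeasurableSpace Ω] {μ : Measure Ω} {m : ℕ}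
    (S : StepFamily μ m) (p p' : ℝ≥0∞) [ENNReal.HolderConjugate p p'] [Fact (1 ≤ p')]
    (x' : StrongDual ℂ (Lp ℂ p' μ))
    (hx' : ‖x'‖ ≤ 1) : ellNorm p (fun j => x' (S.vec p' j)) ≤ 1 := by
  have : ENNReal.HolderConjugate p' p := .symm
  refine ellNorm_le_of_forall_sum_mul_le (t := p') _ fun b => ?_
  have h1 : ∑ j, x' (S.vec p' j) * b j = x' (S.step p' b) := by
    simp [StepFamily.step, mul_comm]
  rw [h1, ← S.enorm_step (ENNReal.HolderConjugate.ne_zero p' p)]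
  refine (ContinuousLinearMap.le_opENorm x' _).trans (mul_le_mul_left ?_ _)
  rw [← ofReal_norm]
  exact ENNReal.ofReal_le_one.2 hx'

/-- By duality with the isometric copies of ℓ_{p'} and ℓ_q, functionals of norm at most 1 take
values on the normalised indicators that lie in the unit balls of ℓ_p and ℓ_{q'}, where t is bounded
by A. -/
theorem injNorm_sum_vec_le (p p' q q' : ℝ≥0∞) [ENNReal.HolderConjugate p p']
    [ENNReal.HolderConjugate q q'] [Fact (1 ≤ p')] [Fact (1 ≤ q)] {m n : ℕ} (S : StepFamily μ₁ m) (R : StepFamily μ₂ n)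
    {t : Fin m → Fin n → ℂ} {A : ℝ≥0∞}
    (ht : ∀ a b, ‖matForm t a b‖ₑ ≤ A * (ellNorm p a * ellNorm q' b)) :
    injNorm (∑ j, ∑ k, t j k • (S.vec p' j ⊗ₜ[ℂ] R.vec q k)) ≤ A := by
  have : ENNReal.HolderConjugate q' q := .symm
  refine iSup₂_le fun x' hx' => iSup₂_le fun y' hy' => ?_
  simp_rw [tensorPairing_sum_right, tensorPairing_smul_right, tensorPairing_tmul_tmul]
  refine (ht (fun j => x' (S.vec p' j)) (fun k => y' (R.vec q k))).trans ?_
  refine mul_le_of_le_one_right' (mul_le_one' ?_ ?_)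
  · exact S.ellNorm_dual_vec_le p p' x' hx'
  · exact R.ellNorm_dual_vec_le q' q y' hy'

theorem exists_pos_finite_subset {Ω : Type*} [MeasurableSpace Ω] {μ : Measure Ω} [IsLocalizable μ]
    {E : Set Ω} (hE : MeasurableSet E) (h0 : μ E ≠ 0) :
    ∃ F ⊆ E, MeasurableSet F ∧ 0 < μ F ∧ μ F < ∞ := by
  rcases eq_or_ne (μ E) ∞ with h | h
  · exact IsLocalizable.semifinite E hE h
  · exact ⟨E, le_rfl, hE, pos_iff_ne_zero.2 h0, lt_top_iff_ne_top.2 h⟩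

variable [IsLocalizable μ₂] (p p' q : ℝ≥0∞) [ENNReal.HolderConjugate p p']
  [ENNReal.HolderConjugate p' p] [Fact (1 ≤ p)] [Fact (1 ≤ p')] [Fact (1 ≤ q)] {φ : Ω₁ × Ω₂ → ℂ} (hφ : MemLinftyProd μ₁ μ₂ φ)

theorem schurMap_tmul_apply (f : Lp ℂ p' μ₁) (g : Lp ℂ q μ₂) (h : Lp ℂ p μ₁) :
    schurMap p p' q hφ (f ⊗ₜ[ℂ] g) h = (ContinuousLinearMap.mul ℂ ℂ).holder q
      (kernelOperator hφ (mulRight p' p h f)) g := rfl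

/-- The matrix coefficients of `T_φ(u)` are the values of `u_φ` at `(h ⊗ k) u`. -/
theorem lpPairing_schurMap (q' : ℝ≥0∞) [ENNReal.HolderConjugate q q'] [Fact (1 ≤ q')]
    (u : Lp ℂ p' μ₁ ⊗[ℂ] Lp ℂ q μ₂) (h : Lp ℂ p μ₁) (k : Lp ℂ q' μ₂) :
    (ContinuousLinearMap.mul ℂ ℂ).lpPairing μ₂ q q' (schurMap p p' q hφ u h) k =
      opPairing (kernelOperatorDual hφ) (TensorProduct.map
        (mulRight p' p h : Lp ℂ p' μ₁ →ₗ[ℂ] Lp ℂ 1 μ₁)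
        (mulRight q q' k : Lp ℂ q μ₂ →ₗ[ℂ] Lp ℂ 1 μ₂) u) := by
  induction u with
  | zero => simp [opPairing]
  | tmul f g =>
    rw [TensorProduct.map_tmul, opPairing_tmul, schurMap_tmul_apply, kernelOperatorDual,
      ContinuousLinearMap.comp_apply, ContinuousLinearMap.lpPairing_eq_integral,
      ContinuousLinearMap.lpPairing_eq_integral]
    refine integral_congr_ae ?_
    rw [ContinuousLinearMap.coe_coe, ContinuousLinearMap.coe_coe, mulRight_apply q q']
    filter_upwards [(ContinuousLinearMap.mul ℂ ℂ).coeFn_holder (r := q)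
      (kernelOperator hφ (mulRight p' p h f)) g,
      (ContinuousLinearMap.mul ℂ ℂ).coeFn_holder (r := 1) g k] with x h1 h2
    rw [h1, h2]
    simp [mul_assoc]
  | add u v hu hv =>
    rw [map_add, map_add, opPairing_add, ← hu, ← hv]
    simp

theorem enorm_lpPairing_schurMap_le (q' : ℝ≥0∞) [ENNReal.HolderConjugate q q'] [Fact (1 ≤ q')]
    (u : Lp ℂ p' μ₁ ⊗[ℂ] Lp ℂ q μ₂) (h : Lp ℂ p μ₁)
    (k : Lp ℂ q' μ₂) :
    ‖opPairing (kernelOperatorDual hφ) (TensorProduct.map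
        (mulRight p' p h : Lp ℂ p' μ₁ →ₗ[ℂ] Lp ℂ 1 μ₁)
        (mulRight q q' k : Lp ℂ q μ₂ →ₗ[ℂ] Lp ℂ 1 μ₂) u)‖ₑ ≤
      ‖schurMap p p' q hφ u‖ₑ * ‖h‖ₑ * ‖k‖ₑ := by
  rw [← lpPairing_schurMap]
  exact (enorm_lpPairing_le _ _).trans
    (mul_le_mul_left (ContinuousLinearMap.le_opENorm _ _) _)

/-- The sum is ⟨T_φ(u)h, k⟩ for u with coefficients t and step functions h, k with coefficients α,
β. This is how the Schur bound is applied to a factored matrix. -/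
theorem enorm_sum_kernelOperatorDual_le (q' : ℝ≥0∞) [ENNReal.HolderConjugate q q'] [Fact (1 ≤ q')]
    {C : ℝ≥0} (hC : SchurBound p p' q hφ C) {m n : ℕ}
    (S : StepFamily μ₁ m) (R : StepFamily μ₂ n) (α : Fin m → ℂ) (β : Fin n → ℂ)
    (t : Fin m → Fin n → ℂ) :
    ‖∑ j, ∑ k, (α j * β k * t j k) * kernelOperatorDual hφ (S.vec 1 j) (R.vec 1 k)‖ₑ ≤
      C * injNorm (∑ j, ∑ k, t j k • (S.vec p' j ⊗ₜ[ℂ] R.vec q k)) * ellNorm p α *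
        ellNorm q' β := by
  have h1 : ∑ j, ∑ k, (α j * β k * t j k) * kernelOperatorDual hφ (S.vec 1 j) (R.vec 1 k) =
      opPairing (kernelOperatorDual hφ) (TensorProduct.map
        (mulRight p' p (S.step p α) : Lp ℂ p' μ₁ →ₗ[ℂ] Lp ℂ 1 μ₁)
        (mulRight q q' (R.step q' β) : Lp ℂ q μ₂ →ₗ[ℂ] Lp ℂ 1 μ₂)
        (∑ j, ∑ k, t j k • (S.vec p' j ⊗ₜ[ℂ] R.vec q k))) := by
    simp only [map_sum, opPairing_sum, map_smul, opPairing_smul, TensorProduct.map_tmul,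
      ContinuousLinearMap.coe_coe, mulRight_vec_step, opPairing_tmul, smul_apply, smul_eq_mul]
    exact Finset.sum_congr rfl fun j _ => Finset.sum_congr rfl fun k _ => by ring
  rw [h1]
  refine (enorm_lpPairing_schurMap_le p p' q hφ q' _ _ _).trans ?_
  rw [S.enorm_step (ENNReal.HolderConjugate.ne_zero p p'),
    R.enorm_step (ENNReal.HolderConjugate.ne_zero q' q)]
  gcongr
  exact hC _

/-- The coordinate matrix of ξ on a step family inherits the dual norm of ξ as its Lapresté bound,
hence factors as α_j β_k t_{jk}; the Schur bound applied to t then controls the average of ξ. -/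
theorem factorableBound_of_schurBound (q' : ℝ≥0∞) [ENNReal.HolderConjugate q q'] [Fact (1 ≤ q')]
    (hqp : q ≤ p) {C : ℝ≥0} (hC : SchurBound p p' q hφ C) :
    FactorableBound q p' (kernelOperatorDual hφ) C := by
  intro ξ
  have hsum : ∀ (m n : ℕ) (S : StepFamily μ₁ m) (R : StepFamily μ₂ n),
      opPairing (kernelOperatorDual hφ) (TensorProduct.map (S.proj : Lp ℂ 1 μ₁ →ₗ[ℂ] Lp ℂ 1 μ₁)
        (R.proj : Lp ℂ 1 μ₂ →ₗ[ℂ] Lp ℂ 1 μ₂) ξ) = ∑ j, ∑ k,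
        tensorPairing (S.coord j ⊗ₜ[ℂ] R.coord k) ξ *
          kernelOperatorDual hφ (S.vec 1 j) (R.vec 1 k) := fun m n S R => by
    simp_rw [map_proj_eq_sum, opPairing_sum, opPairing_smul, opPairing_tmul]
  -- Since 0 · ∞ = 0, the case C = 0 demands that the pairing vanish; it is also excluded when C is
  -- moved inside the infimum.
  rcases eq_or_ne (C : ℝ≥0∞) 0 with h0 | h0
  · rw [h0, zero_mul]
    refine enorm_opPairing_le_of_proj _ _ fun m n S R => ?_
    have h1 := enorm_sum_kernelOperatorDual_le p p' q hφ q' hC S R (fun _ => 1) (fun _ => 1)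
      (fun j k => tensorPairing (S.coord j ⊗ₜ[ℂ] R.coord k) ξ)
    rw [hsum]
    simpa [h0] using h1
  unfold lapresteDualNorm
  simp_rw [ENNReal.mul_iInf_of_ne h0 ENNReal.coe_ne_top]
  refine le_iInf fun M => le_iInf fun N => le_iInf fun _ => le_iInf fun _ => le_iInf fun w =>
    le_iInf fun hw => ?_
  rcases eq_or_ne (lapresteDualNormFin q p' w) ∞ with hA | hA
  · rw [hA, ENNReal.mul_top h0]
    exact le_top
  refine enorm_opPairing_le_of_proj _ _ fun m n S R => ?_
  have hconj := holderConjugate_lapresteExponent (p := p) (p' := p') (q := q) (q' := q') hqp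
  have htr := ENNReal.HolderTriple.of p q'
  have hS : ∀ b : Fin m → ℂ, ‖∑ j, b j • (S.coord j ∘L M.subtypeL)‖ₑ ≤ ellNorm ∞ b :=
    S.enorm_sum_smul_coord_comp_subtypeL_le M
  have hR : ∀ b : Fin n → ℂ, ‖∑ k, b k • (R.coord k ∘L N.subtypeL)‖ₑ ≤ ellNorm ∞ b :=
    R.enorm_sum_smul_coord_comp_subtypeL_le N
  obtain ⟨α, β, t, hα, hβ, hZ, ht⟩ :=
    (lapresteBound_of_lapresteDualNormFin (p := p) (q' := q') hS hR hA).exists_factorization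
      (ENNReal.HolderConjugate.ne_zero p p') (ENNReal.HolderConjugate.ne_zero q' q) hA
      (ρ := (p⁻¹ + q'⁻¹)⁻¹)
  have hZ' : ∀ j k, tensorPairing (S.coord j ⊗ₜ[ℂ] R.coord k) ξ = α j * β k * t j k := by
    intro j k
    rw [← hZ, ← tensorPairing_map, ← hw]
    rfl
  rw [hsum]
  simp_rw [hZ']
  refine (enorm_sum_kernelOperatorDual_le p p' q hφ q' hC S R α β t).trans ?_
  calc _ ≤ C * lapresteDualNormFin q p' w * 1 * 1 := by
        gcongr
        exact injNorm_sum_vec_le p p' q q' S R ht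
    _ = _ := by rw [mul_one, mul_one]

/-- The averaged matrix of (M_h ⊗ M_k)u is η_j ζ_k t_{jk}, where η and ζ collect the local norms of
h and k, and t is bounded by ‖u‖_∨ on ℓ_p × ℓ_{q'}. The easy half of the factorization then bounds
its dual norm. -/
theorem schurBound_of_factorableBound (q' : ℝ≥0∞) [ENNReal.HolderConjugate q q'] [Fact (1 ≤ q')]
    (hqp : q ≤ p) {C : ℝ≥0}
    (hC : FactorableBound q p' (kernelOperatorDual hφ) C) : SchurBound p p' q hφ C := by
  intro u
  have hconj' := holderConjugate_lapresteExponent (p := p) (p' := p') (q := q) (q' := q') hqp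
  have hconj : ENNReal.HolderConjugate (q⁻¹ + p'⁻¹ - 1)⁻¹ (p⁻¹ + q'⁻¹)⁻¹ := .symm
  have htr := ENNReal.HolderTriple.of p q'
  have key : ∀ (h : Lp ℂ p μ₁) (k : Lp ℂ q' μ₂),
      ‖(ContinuousLinearMap.mul ℂ ℂ).lpPairing μ₂ q q' (schurMap p p' q hφ u h) k‖ₑ ≤
        C * injNorm u * ‖h‖ₑ * ‖k‖ₑ := by
    intro h k
    rw [lpPairing_schurMap]
    -- The factorable bound is applied to the averages, whose dual norm can be computed on spans of
    -- indicators.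
    refine enorm_opPairing_le_of_proj _ _ fun m n S R => (hC _).trans ?_
    rw [mul_assoc, mul_assoc]
    refine mul_le_mul_right ?_ _
    obtain ⟨η, V, hη, hV, hVn⟩ := S.exists_coord_comp_mulRight p' p h
    obtain ⟨ζ, W, hζ, hW, hWn⟩ := R.exists_coord_comp_mulRight q q' k
    have ht : ∀ a b, ‖matForm (fun j k => tensorPairing (V j ⊗ₜ[ℂ] W k) u) a b‖ₑ ≤
        injNorm u * (ellNorm p a * ellNorm q' b) := by
      intro a b
      rw [← tensorPairing_sum_sum]
      refine (enorm_tensorPairing_le_injNorm _ _ u).trans ?_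
      gcongr
      · exact hVn a
      · exact hWn b
    have hL := lapresteBound_diag (r := (q⁻¹ + p'⁻¹ - 1)⁻¹) (ρ := (p⁻¹ + q'⁻¹)⁻¹)
      (ENNReal.HolderConjugate.ne_zero p p') (ENNReal.HolderConjugate.ne_zero q' q) ht η ζ
    refine (lapresteDualNorm_map_proj_le (p := p) (q' := q') S R
      (A := injNorm u * (ellNorm p η * ellNorm q' ζ)) ?_).trans ?_
    · convert hL using 3 with j k
      rw [tensorPairing_map, hV, hW, TensorProduct.smul_tmul_smul, tensorPairing_smul_left]
    · gcongr
  rcases eq_or_ne (C * injNorm u) ∞ with hD | hD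
  · rw [hD]
    exact le_top
  refine ContinuousLinearMap.opENorm_le_bound _ fun h => ?_
  rw [Lp.enorm_def (schurMap p p' q hφ u h)]
  -- The converse of Hölder recovers the L^q norm of T_φ(u)h; for q = ∞ this uses that μ₂ is
  -- semifinite.
  refine eLpNorm_le_of_forall_integral_mul_le (q := q')
    (fun E hE h0 => exists_pos_finite_subset hE h0) (Lp.stronglyMeasurable _) (Lp.memLp _)
    fun k hk => ?_
  have h1 := key h (hk.toLp k)
  rw [Lp.enorm_toLp, ContinuousLinearMap.lpPairing_eq_integral] at h1
  refine le_trans (le_of_eq ?_) h1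
  congr 1
  refine integral_congr_ae ?_
  filter_upwards [hk.coeFn_toLp] with x hx
  rw [hx]
  rfl

end Schur

end SchurLp

/-- Both claims hold because the sets of admissible constants coincide. -/
theorem mainTheorem1 {Ω₁ Ω₂ : Type*} [MeasurableSpace Ω₁] [MeasurableSpace Ω₂]
    (μ₁ : Measure Ω₁) (μ₂ : Measure Ω₂) [SchurLp.IsLocalizable μ₁] [SchurLp.IsLocalizable μ₂]
    (p p' q : ℝ≥0∞) [ENNReal.HolderConjugate p p'] [Fact (1 ≤ p)] [Fact (1 ≤ p')] [Fact (1 ≤ q)]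
    (hqp : q ≤ p) (φ : Ω₁ × Ω₂ → ℂ) (hφ : SchurLp.MemLinftyProd μ₁ μ₂ φ) :
    (SchurLp.IsSchurMultiplier p p' q hφ ↔
      SchurLp.IsFactorable q p' (SchurLp.kernelOperatorDual hφ)) ∧
    SchurLp.schurNorm p p' q hφ = SchurLp.factorableNorm q p' (SchurLp.kernelOperatorDual hφ) := by
  have : ENNReal.HolderConjugate p' p := .symm
  have : Fact (1 ≤ ENNReal.conjExponent q) :=
    ⟨ENNReal.HolderConjugate.one_le (ENNReal.conjExponent q) q⟩
  have h : ∀ C, SchurLp.SchurBound p p' q hφ C ↔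
      SchurLp.FactorableBound q p' (SchurLp.kernelOperatorDual hφ) C := fun C =>
    ⟨SchurLp.factorableBound_of_schurBound p p' q hφ (ENNReal.conjExponent q) hqp,
      SchurLp.schurBound_of_factorableBound p p' q hφ (ENNReal.conjExponent q) hqp⟩
  refine ⟨exists_congr h, ?_⟩
  simp_rw [SchurLp.schurNorm, SchurLp.factorableNorm, h]
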